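/- Let $G=(V,E)$ be a finite simple undirected graph with $n=|V|$ vertices. For $U\subseteq V$ let $N(U)$ be the set of vertices outside $U$ that have a neighbour in $U$; $U$ is called $l$-secluded if $|N(U)|\le l$. The length of a path is its number of vertices, and a path is $l$-secluded if its vertex set is. A set $X\subseteq V$ is a twin cover of $G$ if for every edge $\{u,v\}\in E$ we have $u\in X$, or $v\in X$, or $u$ and $v$ are true twins, that is, $N(\{u\})\setminus\{v\}=N(\{v\})\setminus\{u\}$; the twin cover number $\mathrm{tc}(G)$ is the minimum size of a twin cover of $G$. An instance consists of a graph $G$, two vertices $s,t$ of $G$, and two integers $k,l$. Secluded $k$-Path asks whether $G$ has an $l$-secluded $s$-$t$ path of length exactly $k$, and Short Secluded Path asks whether $G$ has an $l$-secluded $s$-$t$ path of length at most $k$. Theorem. Secluded $k$-Path can be solved in $2^{O(\mathrm{tc}(G)^2)}\,n^{O(1)}$ time, and so can Short Secluded Path. That is, for each of the two problems there are a deterministic algorithm and constants $a,b,d\in\mathbb{N}$ such that on every instance $(G,s,t,k,l)$ the algorithm halts with the correct yes/no answer after at most $a\cdot 2^{b\cdot \mathrm{tc}(G)^2}\cdot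 n^{d}$ steps. (The algorithm is a fixed program for a random access machine over the integers with unit-cost addition, subtraction, comparison and memory access; it receives $n$, the adjacency matrix of $G$, $s$, $t$, $k$ and $l$, but neither a twin cover nor $\mathrm{tc}(G)$.) -/

import Mathlib

/-! ## Graph notions -/

namespace Secluded

variable {V : Type*}

/-- `N_G(U)`: the vertices outside `U` that are adjacent to some vertex of `U`. -/
def openNeighborhood (G : SimpleGraph V) (U : Set V) : Set V :=
  {v | v ∉ U ∧ ∃ u ∈ U, G.Adj u v}

/-- On a finite graph: `U` has at most `l` neighbours. -/
def IsSecluded (G : SimpleGraph V) (l : ℤ) (U : Set V) : Prop :=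
  ((openNeighborhood G U).ncard : ℤ) ≤ l

/-- `u` and `v` are adjacent and `N(u) \ {v} = N(v) \ {u}`. -/
def AreTrueTwins (G : SimpleGraph V) (u v : V) : Prop :=
  G.Adj u v ∧ G.neighborSet u \ {v} = G.neighborSet v \ {u}

/-- Every edge has an endpoint in `X` or joins two true twins. -/
def IsTwinCover (G : SimpleGraph V) (X : Set V) : Prop :=
  ∀ u v : V, G.Adj u v → u ∈ X ∨ v ∈ X ∨ AreTrueTwins G u v

/-- The minimum size of a twin cover. For a finite vertex type the set below is nonempty, since
the whole vertex set is a twin cover. -/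
noncomputable def twinCoverNumber (G : SimpleGraph V) : ℕ :=
  sInf {m : ℕ | ∃ X : Finset V, IsTwinCover G (X : Set V) ∧ X.card = m}

/-- Secluded `k`-Path: is there an `l`-secluded `s`-`t` path of length exactly `k`?
The length of a path is its number of vertices, that is, the length of its support. -/
def SecludedKPath (G : SimpleGraph V) (s t : V) (k l : ℤ) : Prop :=
  ∃ p : G.Walk s t, p.IsPath ∧ (p.support.length : ℤ) = k ∧ IsSecluded G l {v | v ∈ p.support}

/-- Short Secluded Path: is there an `l`-secluded `s`-`t` path of length at most `k`? -/
def ShortSecludedPath (G : SimpleGraph V) (s t : V) (k l : ℤ) : Prop :=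
  ∃ p : G.Walk s t, p.IsPath ∧ (p.support.length : ℤ) ≤ k ∧ IsSecluded G l {v | v ∈ p.support}

end Secluded

/-! ## Machine model

A random access machine, programmed by structured programs. A program uses finitely many integer
variables and finitely many integer arrays. Reading a literal, a variable or an array cell, adding,
subtracting, comparing, writing to a variable or an array cell, and branching on a test take one
step each. There is no multiplication, so in `T` steps the bit length of a value grows by at most
`T`, and the model is polynomially equivalent to Turing machines. -/

namespace RAM

/-- The memory: variables `var x` and array cells `arr a i`. -/
structure State where
  var : ℕ → ℤ
  arr : ℕ → ℤ → ℤ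

inductive Expr where
  | lit (z : ℤ)
  | var (x : ℕ)
  | get (a : ℕ) (i : Expr)
  | add (e₁ e₂ : Expr)
  | sub (e₁ e₂ : Expr)
  | lt (e₁ e₂ : Expr)
  | eq (e₁ e₂ : Expr)

namespace Expr

/-- The value of an expression; a comparison has the value `1` if it holds and `0` if not. -/
def value (σ : State) : Expr → ℤ
  | lit z => z
  | var x => σ.var x
  | get a i => σ.arr a (i.value σ)
  | add e₁ e₂ => e₁.value σ + e₂.value σ
  | sub e₁ e₂ => e₁.value σ - e₂.value σ
  | lt e₁ e₂ => if e₁.value σ < e₂.value σ then 1 else 0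
  | eq e₁ e₂ => if e₁.value σ = e₂.value σ then 1 else 0

/-- The number of steps that evaluating an expression takes: one for each operation in it. -/
def cost : Expr → ℕ
  | lit _ => 1
  | var _ => 1
  | get _ i => i.cost + 1
  | add e₁ e₂ => e₁.cost + e₂.cost + 1
  | sub e₁ e₂ => e₁.cost + e₂.cost + 1
  | lt e₁ e₂ => e₁.cost + e₂.cost + 1
  | eq e₁ e₂ => e₁.cost + e₂.cost + 1

end Expr

/-- Programs. A test `e` counts as true if its value is not `0`. -/
inductive Program where
  | skip
  | assign (x : ℕ) (e : Expr)
  | store (a : ℕ) (i e : Expr)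
  | seq (p q : Program)
  | ite (e : Expr) (p q : Program)
  | loop (e : Expr) (p : Program)

/-- Set the variable `x` to `z`. -/
def State.setVar (σ : State) (x : ℕ) (z : ℤ) : State :=
  { σ with var := Function.update σ.var x z }

/-- Set the cell with index `i` of the array `a` to `z`. -/
def State.setArr (σ : State) (a : ℕ) (i z : ℤ) : State :=
  { σ with arr := Function.update σ.arr a (Function.update (σ.arr a) i z) }

/-- `Runs p σ σ' T`: started in the memory `σ`, the program `p` halts after exactly `T` steps, with
memory `σ'`. The program `loop e p` is the loop "while `e ≠ 0` do `p`". -/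
inductive Runs : Program → State → State → ℕ → Prop where
  | skip (σ : State) : Runs .skip σ σ 1
  | assign (σ : State) (x : ℕ) (e : Expr) :
      Runs (.assign x e) σ (σ.setVar x (e.value σ)) (e.cost + 1)
  | store (σ : State) (a : ℕ) (i e : Expr) :
      Runs (.store a i e) σ (σ.setArr a (i.value σ) (e.value σ)) (i.cost + e.cost + 1)
  | seq {p q : Program} {σ₁ σ₂ σ₃ : State} {T₁ T₂ : ℕ} :
      Runs p σ₁ σ₂ T₁ → Runs q σ₂ σ₃ T₂ → Runs (.seq p q) σ₁ σ₃ (T₁ + T₂)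
  | ite_true {e : Expr} {p q : Program} {σ σ' : State} {T : ℕ} :
      e.value σ ≠ 0 → Runs p σ σ' T → Runs (.ite e p q) σ σ' (e.cost + 1 + T)
  | ite_false {e : Expr} {p q : Program} {σ σ' : State} {T : ℕ} :
      e.value σ = 0 → Runs q σ σ' T → Runs (.ite e p q) σ σ' (e.cost + 1 + T)
  | loop_stop {e : Expr} {p : Program} {σ : State} :
      e.value σ = 0 → Runs (.loop e p) σ σ (e.cost + 1)
  | loop_step {e : Expr} {p : Program} {σ₁ σ₂ σ₃ : State} {T₁ T₂ : ℕ} :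
      e.value σ₁ ≠ 0 → Runs p σ₁ σ₂ T₁ → Runs (.loop e p) σ₂ σ₃ T₂ →
        Runs (.loop e p) σ₁ σ₃ (e.cost + 1 + T₁ + T₂)

open Classical in
/-- Started in `σ`, the program halts within `T` steps and leaves the answer to the question `Q`
in variable `0`: the value `1` for yes, the value `0` for no. -/
def AnswersWithin (p : Program) (σ : State) (Q : Prop) (T : ℕ) : Prop :=
  ∃ (σ' : State) (T' : ℕ), Runs p σ σ' T' ∧ T' ≤ T ∧ σ'.var 0 = if Q then 1 else 0

open Classical in
/-- The input memory for an instance `(G, s, t, k, l)` on the vertex set `{0, …, n - 1}`: variables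
`0` to `4` hold `n, s, t, k, l`, and array `0` holds the adjacency matrix of `G` row by row, the
entry for `(u, v)` being in the cell `u * n + v`. Everything else is `0`. -/
noncomputable def inputState {n : ℕ} (G : SimpleGraph (Fin n)) (s t : Fin n) (k l : ℤ) : State where
  var
    | 0 => n
    | 1 => (s : ℕ)
    | 2 => (t : ℕ)
    | 3 => k
    | 4 => l
    | _ => 0
  arr a i :=
    if a = 0 ∧ ∃ u v : Fin n, G.Adj u v ∧ i = ((u * n + v : ℕ) : ℤ) then 1 else 0

end RAM

/-! ### Reasoning about programs: halting within a time bound in a memory with a given property. -/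

namespace RAM

/-! Let X be a twin cover that contains s and t, and let q = |X|. Every edge outside X joins true
twins, so G − X is a disjoint union of cliques, and the members of a clique have the same neighbours
in X. A twin of a path vertex outside X can be inserted right after that vertex, or removed again,
without changing the closed neighbourhood N[R] of the path R (`insert_twin`). Since |N(R)| = |N[R]|
− |R|, a path matters only through N[R] and the lengths to which it can be stretched, and these
reach up to the size of `extension` (`exists_longer`). Removing twins leaves a skeleton, without two
consecutive vertices outside X. It has at most 2q vertices, at most q of them outside X.

In a skeleton the path neighbours of a vertex outside X lie in X. Hence such a vertex may be
exchanged for any unused vertex outside X with the same neighbours in X, and neither the length nor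
N[R] changes (`IsSkeleton.exchange`). Only the extension is affected: it consists of the path
vertices in X and the visited cliques. Exchanges first ensure that every visited clique is entered
through its least vertex, which carries the size of the clique as its weight
(`IsSkeleton.exists_leaders`). Then heavier vertices are at least as good as lighter ones, and of
each type the q most preferred vertices suffice (`IsSkeleton.exists_marked`). So at most q + q·2^q
marked vertices remain, and there are 2^{O(q²)} sequences of at most 2q of them. By
`exists_secluded_iff` it is enough to test each sequence with each of at most n final lengths.

A cover is found greedily, as in the 2-approximation of vertex cover: both endpoints of each
uncovered edge between non-twins are added. With s and t included this gives q ≤ 2·tc(G) + 2.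

On the machine side, the search is written as terms without side effects whose loops are bounded by
registers. `compile_spec` turns terms into programs, and `cost_le` bounds the cost by a polynomial
in the largest number B of rounds. A candidate sequence is a number in base |`marked`|, so B may be
taken as n·2^{O(tc(G)²)}, and a polynomial in B has the required form. -/

@[simp] theorem State.setVar_var_same (σ : State) (x : ℕ) (z : ℤ) : (σ.setVar x z).var x = z := by
  simp [State.setVar]

theorem State.setVar_var_ne (σ : State) {x y : ℕ} (z : ℤ) (h : y ≠ x) :
    (σ.setVar x z).var y = σ.var y := by
  simp [State.setVar, h]

theorem State.setVar_var (σ : State) (x y : ℕ) (z : ℤ) :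
    (σ.setVar x z).var y = if y = x then z else σ.var y := by
  simp [State.setVar, Function.update_apply]

@[simp] theorem State.setVar_arr (σ : State) (x : ℕ) (z : ℤ) : (σ.setVar x z).arr = σ.arr := rfl

@[simp] theorem State.setArr_var (σ : State) (a : ℕ) (i z : ℤ) : (σ.setArr a i z).var = σ.var := rfl

theorem State.setArr_arr (σ : State) (a b : ℕ) (i j z : ℤ) :
    (σ.setArr a i z).arr b j = if b = a ∧ j = i then z else σ.arr b j := by
  by_cases h : b = a
  · subst h; simp [State.setArr, Function.update_apply]
  · simp [State.setArr, h]

/-- Started in `σ`, the program halts within `T` steps in a memory satisfying `Q`. -/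
def Achieves (p : Program) (σ : State) (T : ℕ) (Q : State → Prop) : Prop :=
  ∃ (σ' : State) (T' : ℕ), Runs p σ σ' T' ∧ T' ≤ T ∧ Q σ'

theorem Achieves.mono {p : Program} {σ : State} {T T' : ℕ} {Q Q' : State → Prop}
    (h : Achieves p σ T Q) (hT : T ≤ T') (hQ : ∀ τ, Q τ → Q' τ) : Achieves p σ T' Q' := by
  obtain ⟨τ, S, hr, hS, hq⟩ := h
  exact ⟨τ, S, hr, hS.trans hT, hQ τ hq⟩

theorem Achieves.skip {σ : State} {Q : State → Prop} (h : Q σ) : Achieves .skip σ 1 Q :=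
  ⟨σ, 1, .skip σ, le_rfl, h⟩

theorem Achieves.assign {σ : State} {x : ℕ} {e : Expr} {Q : State → Prop}
    (h : Q (σ.setVar x (e.value σ))) : Achieves (.assign x e) σ (e.cost + 1) Q :=
  ⟨_, _, .assign σ x e, le_rfl, h⟩

theorem Achieves.store {σ : State} {a : ℕ} {i e : Expr} {Q : State → Prop}
    (h : Q (σ.setArr a (i.value σ) (e.value σ))) :
    Achieves (.store a i e) σ (i.cost + e.cost + 1) Q :=
  ⟨_, _, .store σ a i e, le_rfl, h⟩

theorem Achieves.seq {p q : Program} {σ : State} {T₁ T₂ : ℕ} {Q R : State → Prop}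
    (hp : Achieves p σ T₁ Q) (hq : ∀ τ, Q τ → Achieves q τ T₂ R) :
    Achieves (.seq p q) σ (T₁ + T₂) R := by
  obtain ⟨τ, S, hr, hS, hQ⟩ := hp
  obtain ⟨τ', S', hr', hS', hR⟩ := hq τ hQ
  exact ⟨τ', _, .seq hr hr', by omega, hR⟩

theorem Achieves.ite {e : Expr} {p q : Program} {σ : State} {T : ℕ} {Q : State → Prop}
    (hp : e.value σ ≠ 0 → Achieves p σ T Q) (hq : e.value σ = 0 → Achieves q σ T Q) :
    Achieves (.ite e p q) σ (e.cost + 1 + T) Q := by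
  by_cases h : e.value σ = 0
  · obtain ⟨τ, S, hr, hS, hQ⟩ := hq h
    exact ⟨τ, _, .ite_false h hr, by omega, hQ⟩
  · obtain ⟨τ, S, hr, hS, hQ⟩ := hp h
    exact ⟨τ, _, .ite_true h hr, by omega, hQ⟩

/-- `for i = 0, …, b - 1 do p`, where `i` and `b` are variables. -/
def forLoop (i b : ℕ) (p : Program) : Program :=
  .seq (.assign i (.lit 0))
    (.loop (.lt (.var i) (.var b)) (.seq p (.assign i (.add (.var i) (.lit 1)))))

/-- The invariant rule for `forLoop`. -/
theorem Achieves.forLoop {i b : ℕ} (hib : i ≠ b) {p : Program} {σ : State} {N B T : ℕ}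
    (hN : σ.var b = N) (hB : N ≤ B) (I : ℕ → State → Prop)
    (h0 : I 0 (σ.setVar i 0))
    (hI : ∀ z τ x, I z τ → I z (τ.setVar i x))
    (step : ∀ z τ, z < N → I z τ → τ.var i = z → τ.var b = N →
      Achieves p τ T (fun τ' => I (z + 1) τ' ∧ τ'.var i = z ∧ τ'.var b = N)) :
    Achieves (forLoop i b p) σ (B * (T + 8) + 6) (fun τ => I N τ ∧ τ.var b = N) := by
  -- Induction on the number `r` of remaining rounds. A round costs at most `T` for the body, 4 for
  -- the test and 4 for the increment; the last, failing test costs 4. The initial assignment adds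
  -- 2, whence the 6 in the statement.
  have key : ∀ (r z : ℕ) (τ : State), z + r = N → I z τ → τ.var i = z → τ.var b = N →
      Achieves (.loop (.lt (.var i) (.var b)) (.seq p (.assign i (.add (.var i) (.lit 1))))) τ
        (r * (T + 8) + 4) (fun τ => I N τ ∧ τ.var b = N) := by
    intro r
    induction r with
    | zero =>
      intro z τ hz hIz hi hb
      refine ⟨τ, _, Runs.loop_stop ?_, ?_, ?_, hb⟩
      · simp [Expr.value, hi, hb]; omega
      · simp [Expr.cost]
      · have : z = N := by omega
        exact this ▸ hIz
    | succ r ih =>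
      intro z τ hz hIz hi hb
      obtain ⟨τ', S, hr, hS, hI', hi', hb'⟩ := step z τ (by omega) hIz hi hb
      have h1 := Runs.assign τ' i (.add (.var i) (.lit 1))
      obtain ⟨τ'', S', hr', hS', hQ⟩ := ih (z + 1)
        (τ'.setVar i ((Expr.add (.var i) (.lit 1)).value τ')) (by omega) (hI _ _ _ hI')
        (by simp [Expr.value, hi']) (by simp [State.setVar_var_ne _ _ hib.symm, hb'])
      refine ⟨τ'', _, .loop_step ?_ (.seq hr h1) hr', ?_, hQ⟩
      · simp [Expr.value, hi, hb]; omega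
      · simp only [Expr.cost]; rw [Nat.succ_mul]; omega
  have h := Achieves.seq (R := fun τ => I N τ ∧ τ.var b = N)
    (Achieves.assign (σ := σ) (x := i) (e := .lit 0)
    (Q := fun τ => τ = σ.setVar i 0) rfl) (q := .loop (.lt (.var i) (.var b))
      (.seq p (.assign i (.add (.var i) (.lit 1))))) (T₂ := N * (T + 8) + 4) (by
      rintro τ rfl
      exact key N 0 _ (by omega) h0 (by simp) (by simp [State.setVar_var_ne _ _ hib.symm, hN]))
  refine Achieves.mono h ?_ (fun _ h => h)
  have := Nat.mul_le_mul_right (T + 8) hB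
  simp only [Expr.cost]; omega

/-! ## Terms with bounded loops, and their compilation -/

/-- Expressions with conditionals, bounded sums and bounded folds. In `sum i b e` and
`fold i b e₀ e` the variable `b` holds the number of rounds and `i` counts them; in `fold` the
variable `i + 1` holds the accumulator. -/
inductive Term where
  | lit (z : ℤ)
  | var (x : ℕ)
  | get (a : ℕ) (i : Term)
  | add (e₁ e₂ : Term)
  | sub (e₁ e₂ : Term)
  | lt (e₁ e₂ : Term)
  | eq (e₁ e₂ : Term)
  | ite (c e₁ e₂ : Term)
  | sum (i b : ℕ) (e : Term)
  | fold (i b : ℕ) (e₀ e : Term)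

namespace Term

/-- Bound variables are set only in a local copy of the memory, so evaluation has no side effects. A
negative bound counts as zero rounds. -/
def eval : Term → State → ℤ
  | lit z, _ => z
  | var x, σ => σ.var x
  | get a i, σ => σ.arr a (i.eval σ)
  | add e₁ e₂, σ => e₁.eval σ + e₂.eval σ
  | sub e₁ e₂, σ => e₁.eval σ - e₂.eval σ
  | lt e₁ e₂, σ => if e₁.eval σ < e₂.eval σ then 1 else 0
  | eq e₁ e₂, σ => if e₁.eval σ = e₂.eval σ then 1 else 0
  | ite c e₁ e₂, σ => if c.eval σ ≠ 0 then e₁.eval σ else e₂.eval σ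
  | sum i b e, σ => ∑ z ∈ Finset.range (σ.var b).toNat, e.eval (σ.setVar i z)
  | fold i b e₀ e, σ =>
      Nat.rec (e₀.eval σ) (fun z a => e.eval ((σ.setVar i z).setVar (i + 1) a)) (σ.var b).toNat

/-- The variables that may hold the number of rounds of a loop. -/
def IsBound (b : ℕ) : Prop := b = 0 ∨ 5 ≤ b ∧ b < 9

instance (b : ℕ) : Decidable (IsBound b) := inferInstanceAs (Decidable (_ ∨ _))

/-- The free variables belong to `vs`, and no bound variable shadows another variable. -/
def Scoped : List ℕ → Term → Prop
  | _, lit _ => True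
  | vs, var x => x ∈ vs
  | vs, get _ i => i.Scoped vs
  | vs, add e₁ e₂ => e₁.Scoped vs ∧ e₂.Scoped vs
  | vs, sub e₁ e₂ => e₁.Scoped vs ∧ e₂.Scoped vs
  | vs, lt e₁ e₂ => e₁.Scoped vs ∧ e₂.Scoped vs
  | vs, eq e₁ e₂ => e₁.Scoped vs ∧ e₂.Scoped vs
  | vs, ite c e₁ e₂ => c.Scoped vs ∧ e₁.Scoped vs ∧ e₂.Scoped vs
  | vs, sum i b e => i ∉ vs ∧ (10 ≤ i ∧ i < 100) ∧ (IsBound b ∧ b ∈ vs) ∧ e.Scoped (i :: vs)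
  | vs, fold i b e₀ e => (i ∉ vs ∧ i + 1 ∉ vs) ∧ (10 ≤ i ∧ i + 1 < 100) ∧ (IsBound b ∧ b ∈ vs) ∧
      e₀.Scoped vs ∧ e.Scoped (i :: (i + 1) :: vs)

instance decidableScoped : ∀ (vs : List ℕ) (e : Term), Decidable (e.Scoped vs)
  | _, lit _ => inferInstanceAs (Decidable True)
  | vs, var x => inferInstanceAs (Decidable (x ∈ vs))
  | vs, get _ i => decidableScoped vs i
  | vs, add e₁ e₂ => @instDecidableAnd _ _ (decidableScoped vs e₁) (decidableScoped vs e₂)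
  | vs, sub e₁ e₂ => @instDecidableAnd _ _ (decidableScoped vs e₁) (decidableScoped vs e₂)
  | vs, lt e₁ e₂ => @instDecidableAnd _ _ (decidableScoped vs e₁) (decidableScoped vs e₂)
  | vs, eq e₁ e₂ => @instDecidableAnd _ _ (decidableScoped vs e₁) (decidableScoped vs e₂)
  | vs, ite c e₁ e₂ => @instDecidableAnd _ _ (decidableScoped vs c)
      (@instDecidableAnd _ _ (decidableScoped vs e₁) (decidableScoped vs e₂))
  | vs, sum i _ e => @instDecidableAnd _ _ inferInstance (@instDecidableAnd _ _ inferInstance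
      (@instDecidableAnd _ _ inferInstance (decidableScoped (i :: vs) e)))
  | vs, fold i _ e₀ e => @instDecidableAnd _ _ inferInstance (@instDecidableAnd _ _ inferInstance
      (@instDecidableAnd _ _ inferInstance (@instDecidableAnd _ _ (decidableScoped vs e₀)
        (decidableScoped (i :: (i + 1) :: vs) e))))

/-- Compiled code overwrites temporary variables and loop counters; this shows that the values of
other terms do not notice. The list `vs` varies in the induction, because binders enlarge the scope.
-/
theorem eval_congr {e : Term} : ∀ {vs : List ℕ}, e.Scoped vs → ∀ {σ τ : State},
    (∀ y ∈ vs, σ.var y = τ.var y) → σ.arr = τ.arr → e.eval σ = e.eval τ := by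
  induction e with
  | lit z => intros; rfl
  | var x => intro vs h σ τ hv _; exact hv x h
  | get a i ih => intro vs h σ τ hv ha; simp only [eval, ih h hv ha, ha]
  | add e₁ e₂ ih₁ ih₂ => intro vs h σ τ hv ha; simp only [eval, ih₁ h.1 hv ha, ih₂ h.2 hv ha]
  | sub e₁ e₂ ih₁ ih₂ => intro vs h σ τ hv ha; simp only [eval, ih₁ h.1 hv ha, ih₂ h.2 hv ha]
  | lt e₁ e₂ ih₁ ih₂ => intro vs h σ τ hv ha; simp only [eval, ih₁ h.1 hv ha, ih₂ h.2 hv ha]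
  | eq e₁ e₂ ih₁ ih₂ => intro vs h σ τ hv ha; simp only [eval, ih₁ h.1 hv ha, ih₂ h.2 hv ha]
  | ite c e₁ e₂ ihc ih₁ ih₂ =>
    intro vs h σ τ hv ha
    simp only [eval, ihc h.1 hv ha, ih₁ h.2.1 hv ha, ih₂ h.2.2 hv ha]
  | sum i b e ih =>
    intro vs h σ τ hv ha
    obtain ⟨h1, h2, h3, h4⟩ := h
    simp only [eval, hv b h3.2]
    refine Finset.sum_congr rfl fun z _ => ih h4 (fun y hy => ?_) (by simpa using ha)
    simp only [State.setVar_var]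
    split_ifs with hyi
    · rfl
    · exact hv y (by simpa [hyi] using hy)
  | fold i b e₀ e ih₀ ih =>
    intro vs h σ τ hv ha
    obtain ⟨h1, h2, h3, h4, h5⟩ := h
    simp only [eval, hv b h3.2]
    generalize (τ.var b).toNat = N
    induction N with
    | zero => exact ih₀ h4 hv ha
    | succ N ihN =>
      simp only [ihN]
      refine ih h5 (fun y hy => ?_) (by simpa using ha)
      simp only [State.setVar_var]
      split_ifs with hy1 hy2
      · rfl
      · rfl
      · exact hv y (by simpa [hy1, hy2] using hy)

/-- The program that evaluates a term into the variable `x`, with temporary variables above `x`. -/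
def compile : ℕ → Term → Program
  | x, lit z => .assign x (.lit z)
  | x, var y => .assign x (.var y)
  | x, get a i => .seq (compile x i) (.assign x (.get a (.var x)))
  | x, add e₁ e₂ => .seq (compile x e₁) (.seq (compile (x + 1) e₂)
      (.assign x (.add (.var x) (.var (x + 1)))))
  | x, sub e₁ e₂ => .seq (compile x e₁) (.seq (compile (x + 1) e₂)
      (.assign x (.sub (.var x) (.var (x + 1)))))
  | x, lt e₁ e₂ => .seq (compile x e₁) (.seq (compile (x + 1) e₂)
      (.assign x (.lt (.var x) (.var (x + 1)))))
  | x, eq e₁ e₂ => .seq (compile x e₁) (.seq (compile (x + 1) e₂)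
      (.assign x (.eq (.var x) (.var (x + 1)))))
  | x, ite c e₁ e₂ => .seq (compile x c) (.ite (.var x) (compile x e₁) (compile x e₂))
  | x, sum i b e => .seq (.assign x (.lit 0)) (forLoop i b
      (.seq (compile (x + 1) e) (.assign x (.add (.var x) (.var (x + 1))))))
  | x, fold i b e₀ e => .seq (compile x e₀) (.seq (.assign (i + 1) (.var x))
      (.seq (forLoop i b (.seq (compile x e) (.assign (i + 1) (.var x))))
        (.assign x (.var (i + 1)))))

/-- A bound for the cost of evaluating a term in which no loop has more than `B` rounds. -/
def cost (B : ℕ) : Term → ℕ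
  | lit _ => 10
  | var _ => 10
  | get _ i => i.cost B + 10
  | add e₁ e₂ => e₁.cost B + e₂.cost B + 10
  | sub e₁ e₂ => e₁.cost B + e₂.cost B + 10
  | lt e₁ e₂ => e₁.cost B + e₂.cost B + 10
  | eq e₁ e₂ => e₁.cost B + e₂.cost B + 10
  | ite c e₁ e₂ => c.cost B + e₁.cost B + e₂.cost B + 10
  | sum _ _ e => B * (e.cost B + 20) + 20
  | fold _ _ e₀ e => e₀.cost B + B * (e.cost B + 20) + 20

/-- `τ` agrees with `σ` on the variables in `vs`, on the temporary variables below `x`, and on the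
arrays. -/
structure Frame (vs : List ℕ) (x : ℕ) (σ τ : State) : Prop where
  var : ∀ y, y ∈ vs ∨ 100 ≤ y ∧ y < x → τ.var y = σ.var y
  arr : τ.arr = σ.arr

theorem Frame.trans {vs : List ℕ} {x : ℕ} {σ τ υ : State} (h : Frame vs x σ τ)
    (h' : Frame vs x τ υ) : Frame vs x σ υ :=
  ⟨fun y hy => (h'.var y hy).trans (h.var y hy), h'.arr.trans h.arr⟩

theorem Frame.mono {vs ws : List ℕ} {x x' : ℕ} {σ τ : State} (h : Frame ws x' σ τ)
    (hvs : vs ⊆ ws) (hx : x ≤ x') : Frame vs x σ τ :=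
  ⟨fun y hy => h.var y (by rcases hy with hy | hy; exacts [.inl (hvs hy), .inr (by omega)]), h.arr⟩

theorem Frame.setVar {vs : List ℕ} {x y : ℕ} {σ τ : State} (h : Frame vs x σ τ) (z : ℤ)
    (hy : y ∉ vs) (hx : y < 100 ∨ x ≤ y) : Frame vs x σ (τ.setVar y z) := by
  refine ⟨fun w hw => ?_, h.arr⟩
  rw [State.setVar_var_ne, h.var w hw]
  rintro rfl
  rcases hw with hw | hw
  · exact hy hw
  · omega

theorem Frame.refl (vs : List ℕ) (x : ℕ) (σ : State) : Frame vs x σ σ := ⟨fun _ _ => rfl, rfl⟩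

theorem Frame.eval {vs : List ℕ} {x : ℕ} {σ τ : State} (h : Frame vs x σ τ) {e : Term}
    (he : e.Scoped vs) : e.eval τ = e.eval σ :=
  eval_congr he (fun y hy => h.var y (.inl hy)) h.arr

/-- `vs` consists of variables below `100`, and those that may bound loops have values in
`0, …, B`. -/
structure Fits (B : ℕ) (vs : List ℕ) (σ : State) : Prop where
  lt : ∀ y ∈ vs, y < 100
  le : ∀ y ∈ vs, IsBound y → ∃ N ≤ B, σ.var y = (N : ℕ)

theorem Fits.frame {B : ℕ} {vs : List ℕ} {x : ℕ} {σ τ : State} (h : Fits B vs σ)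
    (h' : Frame vs x σ τ) : Fits B vs τ :=
  ⟨h.lt, fun y hy hb => by rw [h'.var y (.inl hy)]; exact h.le y hy hb⟩

theorem Fits.setVar {B : ℕ} {vs : List ℕ} {σ : State} (h : Fits B vs σ) {i : ℕ} (z : ℤ)
    (hi : 10 ≤ i ∧ i < 100) : Fits B (i :: vs) (σ.setVar i z) := by
  refine ⟨?_, ?_⟩
  · simpa using ⟨hi.2, h.lt⟩
  · intro y hy hb
    have hyi : y ≠ i := by unfold IsBound at hb; omega
    rw [State.setVar_var_ne _ _ hyi]
    exact h.le y (by simpa [hyi] using hy) hb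

/-- In round `z` of a loop the actual memory `τ` bears the traces of earlier rounds, but for terms
in scope it is as good as `σ.setVar i z`, the memory used by `eval`. -/
theorem Frame.of_setVar {vs : List ℕ} {x i : ℕ} {σ τ : State} (z : ℤ)
    (h : Frame vs x σ τ) (hi : τ.var i = z) :
    Frame (i :: vs) x (σ.setVar i z) τ := by
  refine ⟨fun y hy => ?_, h.arr⟩
  rw [State.setVar_var]
  split_ifs with hyi
  · rw [hyi, hi]
  · refine h.var y ?_
    rcases hy with hy | hy
    · exact .inl (by simpa [hyi] using hy)
    · exact .inr hy

/-- The common case of the four binary operations: the first value waits in `x` while the second is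
computed with temporaries from `x + 1` on. -/
theorem compile_binary {B x : ℕ} {vs : List ℕ} {e₁ e₂ : Term} {σ : State} {r : Expr} {z : ℤ}
    (hx : 100 ≤ x) (hf : Fits B vs σ) (h₂ : e₂.Scoped vs)
    (ih₁ : Achieves (compile x e₁) σ (e₁.cost B)
      fun τ => τ.var x = e₁.eval σ ∧ Frame vs x σ τ)
    (ih₂ : ∀ {σ : State}, Fits B vs σ → Achieves (compile (x + 1) e₂) σ (e₂.cost B)
      fun τ => τ.var (x + 1) = e₂.eval σ ∧ Frame vs (x + 1) σ τ)
    (hc : r.cost = 3)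
    (hr : ∀ τ : State, τ.var x = e₁.eval σ → τ.var (x + 1) = e₂.eval σ → r.value τ = z) :
    Achieves (.seq (compile x e₁) (.seq (compile (x + 1) e₂) (.assign x r))) σ
      (e₁.cost B + e₂.cost B + 10) fun τ => τ.var x = z ∧ Frame vs x σ τ := by
  refine Achieves.mono (T := e₁.cost B + (e₂.cost B + (r.cost + 1)))
    (Achieves.seq ih₁ ?_) (by omega) (fun _ h => h)
  rintro τ ⟨h1, h2⟩
  refine Achieves.seq (ih₂ (hf.frame h2)) ?_
  rintro τ' ⟨h3, h4⟩
  refine Achieves.assign ⟨?_, ?_⟩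
  · rw [State.setVar_var_same]
    refine hr _ ?_ ?_
    · rw [h4.var x (.inr (by omega)), h1]
    · rw [h3, h2.eval h₂]
  · refine Frame.setVar (h2.trans (h4.mono (List.Subset.refl _) (by omega))) _ ?_ (.inr le_rfl)
    intro h
    have := hf.lt x h
    omega

/-- Source variables lie below 100 and temporaries from 100 on, and a loop counter is never in the
scope of its loop, so evaluation leaves intact all that is still needed. Loops are handled by the
invariant rule. -/
theorem compile_spec {B : ℕ} (e : Term) : ∀ {vs : List ℕ}, e.Scoped vs → ∀ {x : ℕ}, 100 ≤ x →
    ∀ {σ : State}, Fits B vs σ → Achieves (compile x e) σ (e.cost B)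
      fun τ => τ.var x = e.eval σ ∧ Frame vs x σ τ := by
  induction e with
  | lit z =>
    intro vs _ x hx σ hf
    refine Achieves.mono (Achieves.assign ⟨?_, Frame.setVar (Frame.refl _ _ _) _ ?_ (.inr le_rfl)⟩)
      (by simp [cost, Expr.cost]) (fun _ h => h)
    · simp [Expr.value, eval]
    · intro h; have := hf.lt x h; omega
  | var y =>
    intro vs _ x hx σ hf
    refine Achieves.mono (Achieves.assign ⟨?_, Frame.setVar (Frame.refl _ _ _) _ ?_ (.inr le_rfl)⟩)
      (by simp [cost, Expr.cost]) (fun _ h => h)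
    · simp [Expr.value, eval]
    · intro h; have := hf.lt x h; omega
  | get a i ih =>
    intro vs h x hx σ hf
    refine Achieves.mono (T := i.cost B + ((Expr.get a (.var x)).cost + 1))
      (Achieves.seq (ih h hx hf) ?_) (by simp only [cost, Expr.cost]; omega) (fun _ h => h)
    rintro τ ⟨h1, h2⟩
    refine Achieves.assign ⟨?_, Frame.setVar h2 _ ?_ (.inr le_rfl)⟩
    · simp [Expr.value, eval, h1, h2.arr]
    · intro h; have := hf.lt x h; omega
  | add e₁ e₂ ih₁ ih₂ =>
    intro vs h x hx σ hf
    exact compile_binary hx hf h.2 (ih₁ h.1 hx hf) (ih₂ h.2 (by omega)) rfl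
      (fun τ h1 h2 => by simp [Expr.value, eval, h1, h2])
  | sub e₁ e₂ ih₁ ih₂ =>
    intro vs h x hx σ hf
    exact compile_binary hx hf h.2 (ih₁ h.1 hx hf) (ih₂ h.2 (by omega)) rfl
      (fun τ h1 h2 => by simp [Expr.value, eval, h1, h2])
  | lt e₁ e₂ ih₁ ih₂ =>
    intro vs h x hx σ hf
    exact compile_binary hx hf h.2 (ih₁ h.1 hx hf) (ih₂ h.2 (by omega)) rfl
      (fun τ h1 h2 => by simp [Expr.value, eval, h1, h2])
  | eq e₁ e₂ ih₁ ih₂ =>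
    intro vs h x hx σ hf
    exact compile_binary hx hf h.2 (ih₁ h.1 hx hf) (ih₂ h.2 (by omega)) rfl
      (fun τ h1 h2 => by simp [Expr.value, eval, h1, h2])
  | ite c e₁ e₂ ihc ih₁ ih₂ =>
    intro vs h x hx σ hf
    obtain ⟨hc, h₁, h₂⟩ := h
    refine Achieves.mono (T := c.cost B + (1 + 1 + (e₁.cost B + e₂.cost B)))
      (Achieves.seq (ihc hc hx hf) ?_) (by simp only [cost]; omega) (fun _ h => h)
    rintro τ ⟨hv, hτ⟩
    refine Achieves.ite (e := .var x) (fun hne => ?_) (fun heq => ?_)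
    · refine (ih₁ h₁ hx (hf.frame hτ)).mono (by omega) fun υ hυ => ⟨?_, hτ.trans hυ.2⟩
      have : c.eval σ ≠ 0 := by rw [← hv]; exact hne
      rw [hυ.1, hτ.eval h₁, eval, if_pos this]
    · refine (ih₂ h₂ hx (hf.frame hτ)).mono (by omega) fun υ hυ => ⟨?_, hτ.trans hυ.2⟩
      have : ¬ c.eval σ ≠ 0 := by rw [← hv]; exact not_not.2 heq
      rw [hυ.1, hτ.eval h₂, eval, if_neg this]
  | sum i b e ih =>
    intro vs h x hx σ hf
    obtain ⟨hi, hi', ⟨hb, hbv⟩, he⟩ := h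
    obtain ⟨N, hNB, hN⟩ := hf.le b hbv hb
    have hxv : x ∉ vs := fun h => by have := hf.lt x h; omega
    have hbx : b < 10 := by unfold IsBound at hb; omega
    refine Achieves.mono (T := 1 + 1 + (B * (e.cost B + 4 + 8) + 6))
      (Achieves.seq (Achieves.assign (Q := fun τ => τ = σ.setVar x 0) rfl) ?_)
      (by simp only [cost]; nlinarith) (fun _ h => h)
    rintro _ rfl
    refine Achieves.mono (Achieves.forLoop (by omega) (N := N) (B := B) (T := e.cost B + 4)
      (by rw [State.setVar_var_ne _ _ (by omega), hN]) hNB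
      (fun z τ => τ.var x = ∑ w ∈ Finset.range z, e.eval (σ.setVar i w) ∧ Frame vs x σ τ)
      ?_ ?_ ?_) le_rfl ?_
    · refine ⟨?_, ((Frame.refl _ _ _).setVar _ hxv (.inr le_rfl)).setVar _ hi (.inl hi'.2)⟩
      rw [State.setVar_var_ne _ _ (by omega)]; simp
    · rintro z τ y ⟨h1, h2⟩
      exact ⟨by rw [State.setVar_var_ne _ _ (by omega), h1], h2.setVar _ hi (.inl hi'.2)⟩
    · rintro z τ hz ⟨h1, h2⟩ hτi hτb
      have hfr := Frame.of_setVar _ h2 hτi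
      have hft : Fits B (i :: vs) τ := (hf.setVar z hi').frame hfr
      refine Achieves.seq (T₂ := 4) (ih he (by omega) hft) ?_
      rintro υ ⟨h3, h4⟩
      have hυx : υ.var x = τ.var x := h4.var x (.inr (by omega))
      refine (Achieves.assign ⟨⟨?_, ?_⟩, ?_, ?_⟩).mono (by simp [Expr.cost]) (fun _ h => h)
      · rw [State.setVar_var_same]
        simp only [Expr.value]
        rw [hυx, h3, h1, Finset.sum_range_succ, hfr.eval he]
      · exact (h2.trans (h4.mono (by simp) (by omega))).setVar _ hxv (.inr le_rfl)
      · rw [State.setVar_var_ne _ _ (by omega), h4.var i (.inl (by simp)), hτi]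
      · rw [State.setVar_var_ne _ _ (by omega), h4.var b (.inl (by simp [hbv])), hτb]
    · rintro τ ⟨⟨h1, h2⟩, h3⟩
      exact ⟨by rw [h1, eval, hN, Int.toNat_natCast], h2⟩
  | fold i b e₀ e ih₀ ih =>
    intro vs h x hx σ hf
    obtain ⟨⟨hi, hi1⟩, hi', ⟨hb, hbv⟩, he₀, he⟩ := h
    obtain ⟨N, hNB, hN⟩ := hf.le b hbv hb
    have hxv : x ∉ vs := fun h => by have := hf.lt x h; omega
    have hbx : b < 10 := by unfold IsBound at hb; omega
    refine Achieves.mono (T := e₀.cost B + (1 + 1 + ((B * (e.cost B + 2 + 8) + 6) + (1 + 1))))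
      (Achieves.seq (ih₀ he₀ hx hf) ?_)
      (by simp only [cost]; nlinarith) (fun _ h => h)
    rintro τ₀ ⟨h1, h2⟩
    refine Achieves.seq (Achieves.assign (e := .var x)
      (Q := fun τ => τ.var (i + 1) = e₀.eval σ ∧ Frame vs x σ τ)
      ⟨by simp [Expr.value, h1], h2.setVar _ hi1 (.inl hi'.2)⟩) ?_
    rintro τ₁ ⟨h1, h2⟩
    -- The accumulator rests in `i + 1`, outside the temporaries, so the body may be compiled into
    -- `x` again. For sums the partial sum occupies `x` and the body needs `x + 1`.
    refine Achieves.seq (Achieves.forLoop (by omega) (N := N) (B := B) (T := e.cost B + 2)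
      (by rw [h2.var b (.inl hbv), hN]) hNB
      (fun z τ => τ.var (i + 1) = Nat.rec (e₀.eval σ)
        (fun z a => e.eval ((σ.setVar i z).setVar (i + 1) a)) z ∧ Frame vs x σ τ)
      ?_ ?_ ?_) ?_
    · exact ⟨by rw [State.setVar_var_ne _ _ (by omega)]; exact h1,
        h2.setVar _ hi (.inl (by omega))⟩
    · rintro z τ y ⟨h1, h2⟩
      exact ⟨by rw [State.setVar_var_ne _ _ (by omega), h1], h2.setVar _ hi (.inl (by omega))⟩
    · rintro z τ hz ⟨h1, h2⟩ hτi hτb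
      have hfr := Frame.of_setVar _ (Frame.of_setVar _ h2 hτi) h1
      have hsub : i :: (i + 1) :: vs ⊆ (i + 1) :: i :: vs := by
        intro y; simp only [List.mem_cons]; tauto
      have hft : Fits B (i :: (i + 1) :: vs) τ := by
        have h := (((hf.setVar z ⟨hi'.1, by omega⟩).setVar _ ⟨by omega, hi'.2⟩).frame hfr)
        exact ⟨fun y hy => h.lt y (hsub hy), fun y hy => h.le y (hsub hy)⟩
      refine Achieves.seq (T₂ := 2) (ih he hx hft) ?_
      rintro υ ⟨h3, h4⟩
      refine (Achieves.assign (e := .var x) ⟨⟨?_, ?_⟩, ?_, ?_⟩).mono (by simp [Expr.cost])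
        (fun _ h => h)
      · rw [State.setVar_var_same]
        simp only [Expr.value]
        rw [h3, (hfr.mono hsub le_rfl).eval he]
      · exact (h2.trans (h4.mono (fun y hy => by simp [hy]) le_rfl)).setVar _ hi1 (.inl hi'.2)
      · rw [State.setVar_var_ne _ _ (by omega), h4.var i (.inl (by simp)), hτi]
      · rw [State.setVar_var_ne _ _ (by omega), h4.var b (.inl (by simp [hbv])), hτb]
    · rintro τ ⟨⟨h1, h2⟩, h3⟩
      refine Achieves.assign (e := .var (i + 1)) ⟨?_, h2.setVar _ hxv (.inr le_rfl)⟩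
      rw [State.setVar_var_same, eval, hN, Int.toNat_natCast]
      exact h1

/-- The cost of a term is polynomial in the bound for the number of rounds. -/
theorem cost_le (e : Term) : ∃ K D : ℕ, ∀ B, e.cost B ≤ K * (B + 1) ^ D := by
  -- Crude but sufficient: exponents are added, and the 20 absorbs the constant overheads.
  have up : ∀ {K D K' D' : ℕ} (B : ℕ), K * (B + 1) ^ D + K' * (B + 1) ^ D' + 20 ≤
      (K + K' + 20) * (B + 1) ^ (D + D') := by
    intro K D K' D' B
    have h1 : (B + 1) ^ D ≤ (B + 1) ^ (D + D') := Nat.pow_le_pow_right (by omega) (by omega)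
    have h2 : (B + 1) ^ D' ≤ (B + 1) ^ (D + D') := Nat.pow_le_pow_right (by omega) (by omega)
    have h3 : 1 ≤ (B + 1) ^ (D + D') := Nat.one_le_pow _ _ (by omega)
    nlinarith [Nat.mul_le_mul_left K h1, Nat.mul_le_mul_left K' h2]
  have loop : ∀ {K D : ℕ} (c B : ℕ), c ≤ K * (B + 1) ^ D →
      B * (c + 20) + 20 ≤ (K + 20) * (B + 1) ^ (D + 1) := by
    intro K D c B h
    have h3 : 1 ≤ (B + 1) ^ D := Nat.one_le_pow _ _ (by omega)
    rw [pow_succ]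
    have h4 := Nat.mul_le_mul_left B (Nat.add_le_add_right h 20)
    nlinarith [Nat.mul_le_mul_left (B + 1) h3, Nat.zero_le (K * (B + 1) ^ D)]
  have bin : ∀ e₁ e₂ : Term, (∃ K D : ℕ, ∀ B, e₁.cost B ≤ K * (B + 1) ^ D) →
      (∃ K D : ℕ, ∀ B, e₂.cost B ≤ K * (B + 1) ^ D) →
      ∃ K D : ℕ, ∀ B, e₁.cost B + e₂.cost B + 20 ≤ K * (B + 1) ^ D := by
    rintro e₁ e₂ ⟨K, D, h⟩ ⟨K', D', h'⟩
    exact ⟨_, _, fun B => (by have := h B; have := h' B; omega :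
      _ ≤ K * (B + 1) ^ D + K' * (B + 1) ^ D' + 20).trans (up B)⟩
  induction e with
  | lit z => exact ⟨10, 0, fun B => by simp [cost]⟩
  | var y => exact ⟨10, 0, fun B => by simp [cost]⟩
  | get a i ih =>
    obtain ⟨K, D, h⟩ := bin i i ih ih
    exact ⟨K, D, fun B => by have := h B; simp only [cost]; omega⟩
  | add e₁ e₂ ih₁ ih₂ | sub e₁ e₂ ih₁ ih₂ | lt e₁ e₂ ih₁ ih₂ | eq e₁ e₂ ih₁ ih₂ =>
    obtain ⟨K, D, h⟩ := bin e₁ e₂ ih₁ ih₂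
    exact ⟨K, D, fun B => by have := h B; simp only [cost]; omega⟩
  | ite c e₁ e₂ ihc ih₁ ih₂ =>
    obtain ⟨K, D, h⟩ := bin e₁ e₂ ih₁ ih₂
    obtain ⟨K', D', h'⟩ := ihc
    exact ⟨_, _, fun B => (by have := h B; have := h' B; simp only [cost]; omega :
      _ ≤ K * (B + 1) ^ D + K' * (B + 1) ^ D' + 20).trans (up B)⟩
  | sum i b e ih =>
    obtain ⟨K, D, h⟩ := ih
    exact ⟨_, _, fun B => loop _ B (h B)⟩
  | fold i b e₀ e ih₀ ih =>
    obtain ⟨K, D, h⟩ := ih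
    obtain ⟨K', D', h'⟩ := ih₀
    refine ⟨_, _, fun B => le_trans ?_ (up (K := K + 20) (D := D + 1) (K' := K') (D' := D') B)⟩
    have := loop _ B (h B)
    have := h' B
    simp only [cost]
    omega

end Term
end RAM

/-! ### Secluded paths and twin covers: the combinatorial argument. -/

namespace Secluded

open scoped Classical

variable {V : Type*}

/-- The supports of the paths from `s` to `t`. -/
structure IsPathList (G : SimpleGraph V) (s t : V) (R : List V) : Prop where
  nodup : R.Nodup
  chain : R.IsChain G.Adj
  head : R.head? = some s
  last : R.getLast? = some t

/-- A path is determined by its list of vertices, and such lists are what the algorithm enumerates.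
-/
theorem exists_path_iff (G : SimpleGraph V) (s t : V) (P : List V → Prop) :
    (∃ p : G.Walk s t, p.IsPath ∧ P p.support) ↔ ∃ R, IsPathList G s t R ∧ P R := by
  constructor
  · rintro ⟨p, hp, hP⟩
    refine ⟨p.support, ⟨hp.support_nodup, p.isChain_adj_support, ?_, ?_⟩, hP⟩
    · rw [List.head?_eq_some_head p.support_ne_nil, p.head_support]
    · rw [List.getLast?_eq_some_getLast p.support_ne_nil, p.getLast_support]
  · rintro ⟨R, ⟨h1, h2, h3, h4⟩, hP⟩
    have hne : R ≠ [] := by rintro rfl; simp at h3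
    rw [List.head?_eq_some_head hne, Option.some_inj] at h3
    rw [List.getLast?_eq_some_getLast hne, Option.some_inj] at h4
    subst h3 h4
    refine ⟨SimpleGraph.Walk.ofSupport R hne h2, ?_, ?_⟩
    · rw [SimpleGraph.Walk.isPath_def, SimpleGraph.Walk.support_ofSupport]; exact h1
    · rwa [SimpleGraph.Walk.support_ofSupport]

/-- An edge outside the cover joins true twins. In particular adjacency outside `X` is transitive on
distinct vertices, so the components there are cliques. -/
theorem IsTwinCover.adj_iff {G : SimpleGraph V} {X : Set V} (hX : IsTwinCover G X) {u v w : V}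
    (hu : u ∉ X) (hv : v ∉ X) (h : G.Adj u v) (hwu : w ≠ u) (hwv : w ≠ v) :
    G.Adj u w ↔ G.Adj v w := by
  rcases hX u v h with h' | h' | h'
  · exact absurd h' hu
  · exact absurd h' hv
  · have := Set.ext_iff.1 h'.2 w
    simpa [hwu, hwv] using this

/-- Tracks every measure of a path when `v` is exchanged for `u`; written without subtraction
because the values are natural numbers. -/
theorem sum_exchange [DecidableEq V] {S : Finset V} {u v : V} (hv : v ∈ S) (hu : u ∉ S) (g : V → ℕ) :
    ∑ x ∈ insert u (S.erase v), g x + g v = ∑ x ∈ S, g x + g u := by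
  rw [Finset.sum_insert (fun h => hu (Finset.mem_of_mem_erase h)), add_assoc,
    Finset.sum_erase_add S g hv, add_comm]

section Skeleton

variable {G : SimpleGraph V} {X : Finset V} {s t : V}

/-- A path without two consecutive vertices outside `X`. -/
structure IsSkeleton (G : SimpleGraph V) (X : Finset V) (s t : V) (R : List V) : Prop where
  path : IsPathList G s t R
  sparse : R.IsChain fun a b => a ∈ X ∨ b ∈ X

/-- `u` and `v` have the same neighbours in `X`. -/
def SameType (G : SimpleGraph V) (X : Finset V) (u v : V) : Prop :=
  ∀ x ∈ X, G.Adj u x ↔ G.Adj v x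

/-- The path starts in `X`, so `r` has a predecessor, and sparseness puts the predecessor into `X`.
-/
theorem IsSkeleton.exists_adj (hs : s ∈ X) {R : List V} (hR : IsSkeleton G X s t R) {r : V}
    (hr : r ∈ R) (hrX : r ∉ X) : ∃ x ∈ R, x ∈ X ∧ G.Adj r x := by
  obtain ⟨l₁, l₂, rfl⟩ := List.append_of_mem hr
  rcases List.eq_nil_or_concat l₁ with rfl | ⟨l, a, rfl⟩
  · have : r = s := by simpa using hR.path.head
    exact absurd (this ▸ hs) hrX
  · have h1 := hR.path.chain
    have h2 := hR.sparse
    simp only [List.concat_eq_append, List.append_assoc, List.singleton_append,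
      List.isChain_append_cons_cons] at h1 h2
    exact ⟨a, by simp, h2.2.1.resolve_right hrX, h1.2.1.symm⟩

theorem IsTwinCover.sameType (hX : IsTwinCover G (X : Set V)) {u v : V} (hu : u ∉ X) (hv : v ∉ X)
    (h : G.Adj u v) : SameType G X u v := fun x hx =>
  hX.adj_iff (by simpa using hu) (by simpa using hv) h (by rintro rfl; exact hu hx)
    (by rintro rfl; exact hv hx)

end Skeleton

variable [Fintype V]

/-- The vertices on a path and their neighbours. -/
noncomputable def closedNeighborhood (G : SimpleGraph V) (R : List V) : Finset V :=
  {v | v ∈ R ∨ ∃ u ∈ R, G.Adj u v}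

/-- The vertices on a path, and the vertices outside `X` adjacent to a path vertex outside `X`. -/
noncomputable def extension (G : SimpleGraph V) (X : Finset V) (R : List V) : Finset V :=
  {v | v ∈ R ∨ v ∉ X ∧ ∃ u ∈ R, u ∉ X ∧ G.Adj u v}

/-- The vertices of the path belong to its closed neighbourhood, so |N(R)| = |N[R]| − |R|. With N[R]
fixed, a longer path is more secluded. -/
theorem isSecluded_iff (G : SimpleGraph V) (l : ℤ) {R : List V} (hR : R.Nodup) :
    IsSecluded G l {v | v ∈ R} ↔ ((closedNeighborhood G R).card : ℤ) ≤ l + R.length := by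
  have h1 : openNeighborhood G {v | v ∈ R} = ((closedNeighborhood G R \ R.toFinset : Finset V) : Set V) := by
    ext v
    simp [openNeighborhood, closedNeighborhood]
    tauto
  have h2 : R.toFinset ⊆ closedNeighborhood G R := by
    intro v; simp [closedNeighborhood]; tauto
  have h3 := Finset.card_sdiff_add_card_eq_card h2
  rw [List.toFinset_card_of_nodup hR] at h3
  rw [IsSecluded, h1, Set.ncard_coe_finset]
  omega

section TwinCover

variable {G : SimpleGraph V} {X : Finset V} {s t : V}

/-- A path vertex outside the twin cover may be followed by one of its twins. -/
theorem insert_twin (hX : IsTwinCover G (X : Set V)) (ht : t ∈ X) {l₁ l₂ : List V} {r v : V}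
    (hr : r ∉ X) (hv : v ∉ X) (hrv : G.Adj r v) (hvl : v ∉ l₁ ++ r :: l₂) :
    (IsPathList G s t (l₁ ++ r :: v :: l₂) ↔ IsPathList G s t (l₁ ++ r :: l₂)) ∧
    closedNeighborhood G (l₁ ++ r :: v :: l₂) = closedNeighborhood G (l₁ ++ r :: l₂) ∧
    extension G X (l₁ ++ r :: v :: l₂) = extension G X (l₁ ++ r :: l₂) := by
  have hmem : ∀ w, w ∈ l₁ ++ r :: v :: l₂ ↔ w = v ∨ w ∈ l₁ ++ r :: l₂ := by
    intro w; simp; tauto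
  have hrmem : r ∈ l₁ ++ r :: l₂ := by simp
  have hadj : ∀ w, G.Adj v w → w = r ∨ G.Adj r w := by
    intro w hw
    by_cases hwr : w = r
    · exact .inl hwr
    · exact .inr ((hX.adj_iff (by simpa using hr) (by simpa using hv) hrv hwr hw.ne').2 hw)
  refine ⟨?_, ?_, ?_⟩
  · have hnd : (l₁ ++ r :: v :: l₂).Nodup ↔ (l₁ ++ r :: l₂).Nodup := by
      have hp : (l₁ ++ r :: v :: l₂).Perm (v :: (l₁ ++ r :: l₂)) := by
        simpa using List.perm_middle (a := v) (l₁ := l₁ ++ [r]) (l₂ := l₂)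
      rw [hp.nodup_iff, List.nodup_cons]
      exact and_iff_right hvl
    have hhd : (l₁ ++ r :: v :: l₂).head? = (l₁ ++ r :: l₂).head? := by cases l₁ <;> simp
    cases l₂ with
    -- Both sides are false: these lists end outside `X`, but `t ∈ X`.
    | nil =>
      constructor
      · rintro ⟨_, _, _, h⟩
        have : v = t := by simpa [List.getLast?_append] using h
        exact absurd (this ▸ ht) hv
      · rintro ⟨_, _, _, h⟩
        have : r = t := by simpa [List.getLast?_append] using h
        exact absurd (this ▸ ht) hr
    | cons c l₂ =>
      have hlast : (l₁ ++ r :: v :: c :: l₂).getLast? = (l₁ ++ r :: c :: l₂).getLast? := by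
        simp [List.getLast?_append, List.getLast?_cons]
      -- The case `c = r` must be set apart, since `r` is adjacent to `v` but not to itself. On
      -- either side it is excluded because the lists have no repetition.
      have hcr : c = r ∨ G.Adj r c ↔ c = r ∨ G.Adj v c := by
        by_cases hcr : c = r
        · simp [hcr]
        · have hcv : c ≠ v := by rintro rfl; simp at hvl
          rw [hX.adj_iff (by simpa using hr) (by simpa using hv) hrv hcr hcv]
      have hch : c ≠ r → ((l₁ ++ r :: v :: c :: l₂).IsChain G.Adj ↔
          (l₁ ++ r :: c :: l₂).IsChain G.Adj) := by
        intro hne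
        rw [List.isChain_append_cons_cons, List.isChain_append_cons_cons, List.isChain_cons_cons]
        simp only [hne, false_or] at hcr
        tauto
      constructor
      · rintro ⟨h1, h2, h3, h4⟩
        have hne : c ≠ r := by
          rintro rfl
          exact (List.nodup_cons.1 (List.nodup_append.1 (hnd.1 h1)).2.1).1 (by simp)
        exact ⟨hnd.1 h1, (hch hne).1 h2, hhd ▸ h3, hlast ▸ h4⟩
      · rintro ⟨h1, h2, h3, h4⟩
        have hne : c ≠ r := by
          rintro rfl
          exact (List.nodup_cons.1 (List.nodup_append.1 h1).2.1).1 (by simp)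
        exact ⟨hnd.2 h1, (hch hne).2 h2, hhd ▸ h3, hlast ▸ h4⟩
  · ext w
    simp only [closedNeighborhood, Finset.mem_filter, Finset.mem_univ, true_and, hmem]
    constructor
    · rintro ((rfl | h) | ⟨u, rfl | hu, huw⟩)
      · exact .inr ⟨r, hrmem, hrv⟩
      · exact .inl h
      · rcases hadj w huw with rfl | h
        · exact .inl hrmem
        · exact .inr ⟨r, hrmem, h⟩
      · exact .inr ⟨u, hu, huw⟩
    · rintro (h | ⟨u, hu, huw⟩)
      · exact .inl (.inr h)
      · exact .inr ⟨u, .inr hu, huw⟩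
  · ext w
    simp only [extension, Finset.mem_filter, Finset.mem_univ, true_and, hmem]
    constructor
    · rintro ((rfl | h) | ⟨hw, u, rfl | hu, hux, huw⟩)
      · exact .inr ⟨hv, r, hrmem, hr, hrv⟩
      · exact .inl h
      · rcases hadj w huw with rfl | h
        · exact .inl hrmem
        · exact .inr ⟨hw, r, hrmem, hr, h⟩
      · exact .inr ⟨hw, u, hu, hux, huw⟩
    · rintro (h | ⟨hw, u, hu, hux, huw⟩)
      · exact .inl (.inr h)
      · exact .inr ⟨hw, u, .inr hu, hux, huw⟩

/-- A path can be prolonged by twins to every length up to the size of its extension. -/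
theorem exists_longer (hX : IsTwinCover G (X : Set V)) (ht : t ∈ X) {R : List V}
    (hR : IsPathList G s t R) {κ : ℕ} (h1 : R.length ≤ κ) (h2 : κ ≤ (extension G X R).card) :
    ∃ R', IsPathList G s t R' ∧ R'.length = κ ∧
      closedNeighborhood G R' = closedNeighborhood G R := by
  obtain ⟨d, rfl⟩ := Nat.exists_eq_add_of_le h1
  clear h1
  induction d generalizing R with
  | zero => exact ⟨R, hR, rfl, rfl⟩
  | succ d ih =>
    -- Below the full length some vertex of the extension is off the path, and it is a twin of a
    -- path vertex. Inserting it leaves the extension unchanged, so the induction goes on.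
    have hlt : R.toFinset.card < (extension G X R).card := by
      rw [List.toFinset_card_of_nodup hR.nodup]; omega
    obtain ⟨v, hv, hvR⟩ := Finset.exists_mem_notMem_of_card_lt_card hlt
    simp only [List.mem_toFinset] at hvR
    simp only [extension, Finset.mem_filter, Finset.mem_univ, true_and, hvR, false_or] at hv
    obtain ⟨hvX, r, hrR, hrX, hrv⟩ := hv
    obtain ⟨l₁, l₂, rfl⟩ := List.append_of_mem hrR
    obtain ⟨h3, h4, h5⟩ := insert_twin (s := s) hX ht hrX hvX hrv hvR
    obtain ⟨R', h6, h7, h8⟩ := ih (h3.2 hR) (by rw [h5]; simp at h2 ⊢; omega)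
    exact ⟨R', h6, by rw [h7]; simp; omega, h8.trans h4⟩

/-- Two consecutive vertices outside `X` are twins, and the second can be deleted by `insert_twin`.
Induction on the length. -/
theorem exists_skeleton (hX : IsTwinCover G (X : Set V)) (ht : t ∈ X) {R : List V}
    (hR : IsPathList G s t R) :
    ∃ R', IsSkeleton G X s t R' ∧ R'.length ≤ R.length ∧
      closedNeighborhood G R' = closedNeighborhood G R ∧ extension G X R' = extension G X R := by
  induction hn : R.length generalizing R with
  | zero =>
    have := List.length_eq_zero_iff.1 hn
    subst this
    exact absurd hR.head (by simp)
  | succ m ih =>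
    by_cases hs : R.IsChain fun a b => a ∈ X ∨ b ∈ X
    · exact ⟨R, ⟨hR, hs⟩, hn.le, rfl, rfl⟩
    · rw [List.isChain_iff_forall_rel_of_append_cons_cons] at hs
      push Not at hs
      obtain ⟨r, v, l₁, l₂, rfl, hr, hv⟩ := hs
      have hrv : G.Adj r v := (List.isChain_append_cons_cons.1 hR.chain).2.1
      have hvl : v ∉ l₁ ++ r :: l₂ := by
        have hp : (l₁ ++ r :: v :: l₂).Perm (v :: (l₁ ++ r :: l₂)) := by
          simpa using List.perm_middle (a := v) (l₁ := l₁ ++ [r]) (l₂ := l₂)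
        exact (List.nodup_cons.1 (hp.nodup_iff.1 hR.nodup)).1
      obtain ⟨h3, h4, h5⟩ := insert_twin (s := s) hX ht hr hv hrv hvl
      obtain ⟨R', h6, h7, h8, h9⟩ := ih (h3.1 hR) (by simp at hn ⊢; omega)
      exact ⟨R', h6, by omega, h8.trans h4.symm, h9.trans h5.symm⟩

/-- A neighbour outside `X` of a path vertex `r` outside `X` is a twin of `r`, hence adjacent to the
`X`-vertex before `r` on the path. So `r` contributes only its neighbours in `X`, and these depend
only on its type. This is why exchanges preserve the closed neighbourhood. -/
theorem IsSkeleton.mem_closedNeighborhood (hX : IsTwinCover G (X : Set V)) (hs : s ∈ X)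
    {R : List V} (hR : IsSkeleton G X s t R) (w : V) :
    w ∈ closedNeighborhood G R ↔ (∃ x ∈ R, x ∈ X ∧ (x = w ∨ G.Adj x w)) ∨
      w ∈ X ∧ ∃ r ∈ R, r ∉ X ∧ G.Adj r w := by
  simp only [closedNeighborhood, Finset.mem_filter, Finset.mem_univ, true_and]
  constructor
  · rintro (hw | ⟨u, hu, huw⟩)
    · by_cases hwX : w ∈ X
      · exact .inl ⟨w, hw, hwX, .inl rfl⟩
      · obtain ⟨x, hx, hxX, h⟩ := hR.exists_adj hs hw hwX
        exact .inl ⟨x, hx, hxX, .inr h.symm⟩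
    · by_cases huX : u ∈ X
      · exact .inl ⟨u, hu, huX, .inr huw⟩
      · by_cases hwX : w ∈ X
        · exact .inr ⟨hwX, u, hu, huX, huw⟩
        · obtain ⟨x, hx, hxX, h⟩ := hR.exists_adj hs hu huX
          refine .inl ⟨x, hx, hxX, .inr ?_⟩
          exact ((hX.adj_iff (by simpa using huX) (by simpa using hwX) huw
            (by rintro rfl; exact huX hxX) (by rintro rfl; exact hwX hxX)).1 h).symm
  · rintro (⟨x, hx, hxX, rfl | h⟩ | ⟨hwX, r, hr, hrX, h⟩)
    · exact .inl hx
    · exact .inr ⟨x, hx, h⟩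
    · exact .inr ⟨r, hr, h⟩

/-! ### Exchange arguments: leaders of cliques and marked vertices. -/

variable [LinearOrder V]

/-- A vertex of a skeleton may be exchanged for another vertex of the same type. -/
theorem IsSkeleton.exchange (hX : IsTwinCover G (X : Set V)) (hs : s ∈ X) (ht : t ∈ X)
    {R : List V} (hR : IsSkeleton G X s t R) {u v : V} (hv : v ∈ R) (hvX : v ∉ X) (hu : u ∉ R)
    (huX : u ∉ X) (huv : SameType G X u v) :
    ∃ R', IsSkeleton G X s t R' ∧ R'.toFinset = insert u (R.toFinset.erase v) ∧
      R'.length = R.length ∧ closedNeighborhood G R' = closedNeighborhood G R := by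
  set f : V → V := fun x => if x = v then u else x with hf
  have fX : ∀ x, x ∈ X → f x = x := by
    intro x hx; simp only [hf]; rw [if_neg]; rintro rfl; exact hvX hx
  have fX' : ∀ x, f x ∈ X ↔ x ∈ X := by
    intro x; simp only [hf]; split_ifs with h
    · subst h; simp [hvX, huX]
    · rfl
  have fadj : ∀ x y, y ∈ X → (G.Adj (f x) y ↔ G.Adj x y) := by
    intro x y hy
    simp only [hf]
    split_ifs with h
    · subst h; exact huv y hy
    · rfl
  have hmem : ∀ w, w ∈ R.map f ↔ w = u ∨ w ≠ v ∧ w ∈ R := by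
    intro w
    simp only [List.mem_map, hf]
    constructor
    · rintro ⟨x, hx, rfl⟩
      split_ifs with h
      · exact .inl rfl
      · exact .inr ⟨h, hx⟩
    · rintro (rfl | ⟨h, hw⟩)
      · exact ⟨v, hv, by simp⟩
      · exact ⟨w, hw, by simp [h]⟩
  have hR' : IsSkeleton G X s t (R.map f) := by
    have hch := List.isChain_iff_forall_rel_of_append_cons_cons.1 hR.path.chain
    have hsp := List.isChain_iff_forall_rel_of_append_cons_cons.1 hR.sparse
    refine ⟨⟨?_, ?_, ?_, ?_⟩, ?_⟩
    · refine (List.nodup_map_iff_inj_on hR.path.nodup).2 fun x hx y hy hxy => ?_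
      simp only [hf] at hxy
      split_ifs at hxy with h1 h2 h2
      · exact h1.trans h2.symm
      · exact absurd (hxy ▸ hy) hu
      · exact absurd (hxy ▸ hx) hu
      · exact hxy
    · rw [List.isChain_map, List.isChain_iff_forall_rel_of_append_cons_cons]
      intro a b l₁ l₂ h
      -- One vertex of a consecutive pair lies in `X` and is fixed by `f`, so the type of the other
      -- decides adjacency.
      rcases hsp h with ha | hb
      · rw [fX a ha, G.adj_comm, fadj b a ha, G.adj_comm]; exact hch h
      · rw [fX b hb, fadj a b hb]; exact hch h
    · rw [List.head?_map, hR.path.head, Option.map_some, fX s hs]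
    · rw [List.getLast?_map, hR.path.last, Option.map_some, fX t ht]
    · rw [List.isChain_map]
      exact hR.sparse.imp fun a b h => by rwa [fX', fX']
  refine ⟨R.map f, hR', ?_, by simp, ?_⟩
  · ext w
    rw [List.mem_toFinset, hmem]
    simp
  · ext w
    rw [hR'.mem_closedNeighborhood hX hs, hR.mem_closedNeighborhood hX hs]
    simp only [List.mem_map, exists_exists_and_eq_and, fX']
    refine or_congr (exists_congr fun x => and_congr_right fun _ => and_congr_right fun hx => ?_)
      (and_congr_right fun hw => exists_congr fun r => ?_)
    · rw [fX x hx]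
    · rw [fadj r w hw]

/-- The clique of `v` outside `X`, if `v ∉ X`. -/
noncomputable def clique (G : SimpleGraph V) (X : Finset V) (v : V) : Finset V :=
  {u | u ∉ X ∧ (u = v ∨ G.Adj u v)}

/-- `v` is the first vertex of its clique outside `X`. -/
def IsLeader (G : SimpleGraph V) (X : Finset V) (v : V) : Prop :=
  v ∉ X ∧ ∀ u, u ∉ X → G.Adj u v → ¬ u < v

/-- The size of the clique for its first vertex, and `0` for the other vertices. -/
noncomputable def weight (G : SimpleGraph V) (X : Finset V) (v : V) : ℕ :=
  if IsLeader G X v then (clique G X v).card else 0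

/-- The vertices that are preferred to `v`. -/
noncomputable def preferred (G : SimpleGraph V) (X : Finset V) (v : V) : Finset V :=
  {u | u ∉ X ∧ SameType G X u v ∧
    (weight G X v < weight G X u ∨ weight G X v = weight G X u ∧ v < u)}

/-- The vertices of `X` and, of each type, the `|X|` most preferred vertices outside `X`. -/
noncomputable def marked (G : SimpleGraph V) (X : Finset V) : Finset V :=
  {v | v ∈ X ∨ (preferred G X v).card < X.card}

/-- The least vertex of the clique of `v`. Its own clique is the same one, again because twins share
their neighbours. -/
theorem exists_leader (hX : IsTwinCover G (X : Set V)) {v : V} (hv : v ∉ X) :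
    ∃ u, IsLeader G X u ∧ (u = v ∨ G.Adj u v) := by
  have hne : (clique G X v).Nonempty := ⟨v, by simp [clique, hv]⟩
  obtain ⟨u, hu, hmin⟩ := Finset.exists_min_image _ id hne
  simp only [clique, Finset.mem_filter, Finset.mem_univ, true_and, id] at hu hmin
  refine ⟨u, ⟨hu.1, fun w hw hwu => not_lt.2 (hmin w ⟨hw, ?_⟩)⟩, hu.2⟩
  rcases hu.2 with rfl | huv
  · exact .inr hwu
  · by_cases hwv : w = v
    · exact .inl hwv
    · exact .inr (((hX.adj_iff (by simpa using hu.1) (by simpa using hv) huv hwu.ne hwv).1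
        hwu.symm).symm)

/-- The part of a path inside `X`, and the cliques whose first vertex is on the path. -/
noncomputable def potential (G : SimpleGraph V) (X : Finset V) (R : List V) : ℕ :=
  ∑ v ∈ R.toFinset, ((if v ∈ X then 1 else 0) + weight G X v)

/-- Distinct leaders have disjoint cliques, since the smaller of two adjacent vertices outside `X`
prevents the other from being a leader. The clique of a leader on the path lies in the extension. -/
theorem potential_le_card_extension (hX : IsTwinCover G (X : Set V)) (R : List V) :
    potential G X R ≤ (extension G X R).card := by
  have h1 : potential G X R = (R.toFinset.filter (· ∈ X)).card +
      ((R.toFinset.filter (IsLeader G X)).biUnion (clique G X)).card := by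
    rw [potential, Finset.sum_add_distrib, Finset.card_filter, Finset.card_biUnion,
      Finset.sum_filter]
    · rfl
    · intro u hu v hv huv
      rw [Function.onFun, Finset.disjoint_left]
      intro w hwu hwv
      rw [Finset.mem_coe, Finset.mem_filter] at hu hv
      simp only [clique, Finset.mem_filter, Finset.mem_univ, true_and] at hwu hwv
      have hadj : G.Adj u v := by
        rcases hwu.2 with rfl | hu'
        · exact hwv.2.resolve_left huv
        · rcases hwv.2 with rfl | hv'
          · exact hu'.symm
          · exact ((hX.adj_iff (by simpa using hwu.1) (by simpa using hu.2.1) hu' hv'.ne' huv.symm).1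
              hv')
      rcases lt_or_gt_of_ne huv with h | h
      · exact hv.2.2 u hu.2.1 hadj h
      · exact hu.2.2 v hv.2.1 hadj.symm h
  rw [h1, ← Finset.card_union_of_disjoint]
  · refine Finset.card_le_card fun w hw => ?_
    simp only [extension, clique, Finset.mem_union, Finset.mem_filter, Finset.mem_biUnion,
      List.mem_toFinset, Finset.mem_univ, true_and] at hw ⊢
    rcases hw with hw | ⟨u, ⟨huR, hu⟩, hw, rfl | h⟩
    · exact .inl hw.1
    · exact .inl huR
    · exact .inr ⟨hw, u, huR, hu.1, h.symm⟩
  · rw [Finset.disjoint_left]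
    intro w hw hw'
    simp only [clique, Finset.mem_filter, Finset.mem_biUnion, Finset.mem_univ, true_and] at hw hw'
    obtain ⟨u, _, h, _⟩ := hw'
    exact h hw.2

/-- If the leader of every visited clique is on the path, then the cliques of these leaders cover
the part of the extension outside `X`. -/
theorem card_extension_le_potential {R : List V}
    (hR : ∀ v ∈ R, v ∉ X → ∃ u ∈ R, IsLeader G X u ∧ (u = v ∨ G.Adj u v))
    (hX : IsTwinCover G (X : Set V)) : (extension G X R).card ≤ potential G X R := by
  have h1 : extension G X R ⊆ R.toFinset.filter (· ∈ X) ∪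
      (R.toFinset.filter (IsLeader G X)).biUnion (clique G X) := by
    intro w hw
    simp only [extension, clique, Finset.mem_union, Finset.mem_filter, Finset.mem_biUnion,
      List.mem_toFinset, Finset.mem_univ, true_and] at hw ⊢
    by_cases hwX : w ∈ X
    · simp only [hwX, not_true, false_and, or_false] at hw
      exact .inl ⟨hw, hwX⟩
    · right
      have : ∃ v ∈ R, v ∉ X ∧ (v = w ∨ G.Adj v w) := by
        rcases hw with hw | ⟨_, v, hv, hvX, h⟩
        · exact ⟨w, hw, hwX, .inl rfl⟩
        · exact ⟨v, hv, hvX, .inr h⟩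
      obtain ⟨v, hv, hvX, hvw⟩ := this
      obtain ⟨u, hu, hul, huv⟩ := hR v hv hvX
      refine ⟨u, ⟨hu, hul⟩, hwX, ?_⟩
      rcases hvw with rfl | hvw
      · exact huv.imp Eq.symm fun h => h.symm
      · rcases huv with rfl | huv
        · exact .inr hvw.symm
        · by_cases huw : w = u
          · exact .inl huw
          · exact .inr ((hX.adj_iff (by simpa using hul.1) (by simpa using hvX) huv huw hvw.ne').2
              hvw).symm
  refine (Finset.card_le_card h1).trans ((Finset.card_union_le _ _).trans ?_)
  rw [potential, Finset.sum_add_distrib, Finset.card_filter]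
  refine Nat.add_le_add_left (Finset.card_biUnion_le.trans ?_) _
  rw [Finset.sum_filter]
  rfl

/-- A path vertex whose clique has its leader off the path is exchanged for that leader, a twin and
hence of the same type. The number of path vertices that are not leaders decreases, and the
extension does not shrink. -/
theorem IsSkeleton.exists_leaders (hX : IsTwinCover G (X : Set V)) (hs : s ∈ X) (ht : t ∈ X)
    {R : List V} (hR : IsSkeleton G X s t R) :
    ∃ R', IsSkeleton G X s t R' ∧ R'.length = R.length ∧
      closedNeighborhood G R' = closedNeighborhood G R ∧
      (extension G X R).card ≤ potential G X R' := by
  induction hm : (∑ x ∈ R.toFinset, if IsLeader G X x then 0 else 1 : ℕ) using Nat.strong_induction_on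
    generalizing R with
  | _ m ih =>
    by_cases h : ∀ v ∈ R, v ∉ X → ∃ u ∈ R, IsLeader G X u ∧ (u = v ∨ G.Adj u v)
    · exact ⟨R, hR, rfl, rfl, card_extension_le_potential h hX⟩
    · push Not at h
      obtain ⟨v, hv, hvX, hno⟩ := h
      obtain ⟨u, hu, huv⟩ := exists_leader hX hvX
      have huR : u ∉ R := fun hR' => by
        have := hno u hR' hu
        tauto
      have hvu : G.Adj u v := huv.resolve_left (by rintro rfl; exact huR hv)
      have hvl : ¬ IsLeader G X v := fun hl => (hno v hv hl).1 rfl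
      obtain ⟨R₁, h1, h2, h3, h4⟩ := hR.exchange hX hs ht hv hvX huR hu.1
        (hX.sameType hu.1 hvX hvu)
      have hsum := sum_exchange (List.mem_toFinset.2 hv) (fun h => huR (List.mem_toFinset.1 h))
        (fun x => if IsLeader G X x then 0 else 1)
      rw [← h2, hm] at hsum
      simp only [hu, hvl, if_true, if_false] at hsum
      obtain ⟨R', h5, h6, h7, h8⟩ := ih _ (by omega) h1 rfl
      refine ⟨R', h5, h6.trans h3, h7.trans h4, (Finset.card_le_card fun w hw => ?_).trans h8⟩
      have hmem : ∀ w, w ∈ R₁ ↔ w = u ∨ w ≠ v ∧ w ∈ R := by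
        intro w; rw [← List.mem_toFinset, h2]; simp
      simp only [extension, Finset.mem_filter, Finset.mem_univ, true_and, hmem] at hw ⊢
      -- The twin `u` takes over what `v` contributed to the extension: `v` itself and the
      -- neighbours of `v` outside `X`.
      have key : w ∉ X → (w = v ∨ G.Adj v w) → ((w = u ∨ w ≠ v ∧ w ∈ R) ∨
          w ∉ X ∧ ∃ x, (x = u ∨ x ≠ v ∧ x ∈ R) ∧ x ∉ X ∧ G.Adj x w) := by
        intro hw h
        by_cases hwu : w = u
        · exact .inl (.inl hwu)
        · refine .inr ⟨hw, u, .inl rfl, hu.1, ?_⟩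
          rcases h with rfl | h
          · exact hvu
          · exact (hX.adj_iff (by simpa using hu.1) (by simpa using hvX) hvu hwu h.ne').2 h
      rcases hw with hw | ⟨hw, x, hx, hxX, h⟩
      · by_cases hwv : w = v
        · exact key (hwv ▸ hvX) (.inl hwv)
        · exact .inl (.inr ⟨hwv, hw⟩)
      · by_cases hxv : x = v
        · exact key hw (.inr (hxv ▸ h))
        · exact .inr ⟨hw, x, .inr ⟨hxv, hx⟩, hxX, h⟩

/-- A skeleton has at most as many vertices outside `X` as inside. -/
theorem countP_notMem_le {R : List V} (hR : R.IsChain fun a b => a ∈ X ∨ b ∈ X)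
    (hs : ∀ a ∈ R.head?, a ∈ X) : R.countP (· ∉ X) ≤ R.countP (· ∈ X) := by
  -- The bound with the additional 1 is for tails that start outside `X`; the induction needs both
  -- bounds at once.
  have key : ∀ R : List V, R.IsChain (fun a b => a ∈ X ∨ b ∈ X) →
      R.countP (· ∉ X) ≤ R.countP (· ∈ X) + 1 ∧
      ((∀ a ∈ R.head?, a ∈ X) → R.countP (· ∉ X) ≤ R.countP (· ∈ X)) := by
    intro R
    induction R with
    | nil => simp
    | cons a R ih =>
      intro h
      rw [List.isChain_cons] at h
      obtain ⟨h1, h2⟩ := ih h.2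
      by_cases ha : a ∈ X
      · simp only [List.countP_cons, ha, not_true_eq_false, decide_true,
          decide_false, if_true, Bool.false_eq_true, if_false]
        omega
      · have := h2 fun b hb => (h.1 b hb).resolve_left ha
        simp only [List.countP_cons, ha, not_false_eq_true, decide_true,
          decide_false, if_true, Bool.false_eq_true, if_false]
        exact ⟨by omega, fun h' => absurd (h' a (by simp)) ha⟩
  exact (key R hR).2 hs

/-- The first bound shows that |X| marked vertices per type are enough, the second that codes with
2|X| digits are enough. -/
theorem IsSkeleton.card_notMem_le (hs : s ∈ X) {R : List V} (hR : IsSkeleton G X s t R) :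
    (R.toFinset \ X).card ≤ X.card ∧ R.length ≤ 2 * X.card := by
  have h1 := countP_notMem_le hR.sparse (by rw [hR.path.head]; simpa using hs)
  have h2 : ∀ (p : V → Prop) [DecidablePred p], R.countP (fun x => p x) = (R.toFinset.filter p).card := by
    intro p _
    rw [List.countP_eq_length_filter, ← List.toFinset_card_of_nodup (hR.path.nodup.filter _),
      List.toFinset_filter]
    simp
  have h3 : (R.toFinset.filter (· ∈ X)).card ≤ X.card :=
    Finset.card_le_card fun w hw => (Finset.mem_filter.1 hw).2
  have h4 : R.toFinset \ X = R.toFinset.filter (· ∉ X) := by ext; simp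
  have h5 := Finset.card_filter_add_card_filter_not (s := R.toFinset) (· ∈ X)
  rw [List.toFinset_card_of_nodup hR.path.nodup] at h5
  have h6 := h2 (· ∈ X)
  have h7 := h2 (· ∉ X)
  rw [h4]
  omega

/-- An unmarked path vertex is exchanged for an unused vertex preferred to it. Its weight is at
least as large, so the potential does not drop, while the sum of the numbers of preferred vertices
decreases. -/
theorem IsSkeleton.exists_marked (hX : IsTwinCover G (X : Set V)) (hs : s ∈ X) (ht : t ∈ X)
    {R : List V} (hR : IsSkeleton G X s t R) :
    ∃ R', IsSkeleton G X s t R' ∧ R'.length = R.length ∧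
      closedNeighborhood G R' = closedNeighborhood G R ∧
      potential G X R ≤ potential G X R' ∧ ∀ v ∈ R', v ∈ marked G X := by
  induction hm : (∑ x ∈ R.toFinset, (preferred G X x).card) using Nat.strong_induction_on
    generalizing R with
  | _ m ih =>
    by_cases h : ∀ v ∈ R, v ∈ marked G X
    · exact ⟨R, hR, rfl, rfl, le_rfl, h⟩
    · push Not at h
      obtain ⟨v, hv, hvm⟩ := h
      simp only [marked, Finset.mem_filter, Finset.mem_univ, true_and, not_or, not_lt] at hvm
      obtain ⟨hvX, hcard⟩ := hvm
      have hvp : v ∉ preferred G X v := by simp [preferred]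
      have : ∃ u ∈ preferred G X v, u ∉ R := by
        -- Otherwise `v` and at least |X| vertices preferred to it are all on the path and outside
        -- `X`, one more than a skeleton allows.
        by_contra! hsub
        have h1 : insert v (preferred G X v) ⊆ R.toFinset \ X := by
          intro w hw
          rw [Finset.mem_insert] at hw
          rw [Finset.mem_sdiff, List.mem_toFinset]
          rcases hw with rfl | hw
          · exact ⟨hv, hvX⟩
          · exact ⟨hsub w hw, (by simpa [preferred] using hw : w ∉ X ∧ _).1⟩
        have h2 := Finset.card_le_card h1
        rw [Finset.card_insert_of_notMem hvp] at h2
        have := (hR.card_notMem_le hs).1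
        omega
      obtain ⟨u, hup, huR⟩ := this
      have hup' := hup
      simp only [preferred, Finset.mem_filter, Finset.mem_univ, true_and] at hup
      obtain ⟨huX, huv, hpr⟩ := hup
      obtain ⟨R₁, h1, h2, h3, h4⟩ := hR.exchange hX hs ht hv hvX huR huX huv
      have hsum := fun g => sum_exchange (List.mem_toFinset.2 hv)
        (fun h => huR (List.mem_toFinset.1 h)) g
      rw [← h2] at hsum
      -- Preference is transitive and irreflexive within a type, and `u` is preferred to `v` but not
      -- to itself.
      have hlt : (preferred G X u).card < (preferred G X v).card := by
        refine Finset.card_lt_card ⟨fun w hw => ?_, fun h => ?_⟩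
        · simp only [preferred, Finset.mem_filter, Finset.mem_univ, true_and] at hw ⊢
          refine ⟨hw.1, fun x hx => (hw.2.1 x hx).trans (huv x hx), ?_⟩
          rcases hpr with h | ⟨h, h'⟩ <;> rcases hw.2.2 with k | ⟨k, k'⟩
          · exact .inl (h.trans k)
          · exact .inl (k ▸ h)
          · exact .inl (h ▸ k)
          · exact .inr ⟨h.trans k, h'.trans k'⟩
        · have := h hup'
          simp [preferred] at this
      have hs1 := hsum fun x => (preferred G X x).card
      rw [hm] at hs1
      have hs2 := hsum fun x => (if x ∈ X then 1 else 0) + weight G X x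
      simp only [hvX, huX, if_false, zero_add] at hs2
      obtain ⟨R', h5, h6, h7, h8, h9⟩ := ih _ (by omega) h1 rfl
      refine ⟨R', h5, h6.trans h3, h7.trans h4, le_trans ?_ h8, h9⟩
      unfold potential
      rcases hpr with h | h <;> omega

/-- A secluded path exists if and only if one can be found by prolonging a short path through
marked vertices. -/
theorem exists_secluded_iff (hX : IsTwinCover G (X : Set V)) (hs : s ∈ X) (ht : t ∈ X)
    (P : ℕ → Prop) (l : ℤ) :
    (∃ R, IsPathList G s t R ∧ P R.length ∧ IsSecluded G l {v | v ∈ R}) ↔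
    ∃ R, IsPathList G s t R ∧ (∀ v ∈ R, v ∈ marked G X) ∧ R.length ≤ 2 * X.card ∧
      ∃ κ : ℕ, P κ ∧ R.length ≤ κ ∧ κ ≤ (extension G X R).card ∧
        ((closedNeighborhood G R).card : ℤ) ≤ l + κ := by
  constructor
  · rintro ⟨R, hR, hP, hsec⟩
    rw [isSecluded_iff G l hR.nodup] at hsec
    have hext : R.length ≤ (extension G X R).card := by
      rw [← List.toFinset_card_of_nodup hR.nodup]
      exact Finset.card_le_card fun w hw => by
        simp only [extension, Finset.mem_filter, Finset.mem_univ, true_and]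
        exact .inl (List.mem_toFinset.1 hw)
    obtain ⟨R₁, h1, h2, h3, h4⟩ := exists_skeleton hX ht hR
    obtain ⟨R₂, h5, h6, h7, h8⟩ := h1.exists_leaders hX hs ht
    obtain ⟨R₃, h9, h10, h11, h12, h13⟩ := h5.exists_marked hX hs ht
    have h14 := potential_le_card_extension (G := G) hX R₃
    rw [h4] at h8
    -- The final length κ is that of the original path. It can be reached because |ext R| = |ext R₁|
    -- ≤ pot R₂ ≤ pot R₃ ≤ |ext R₃|.
    refine ⟨R₃, h9.path, h13, (h9.card_notMem_le hs).2, R.length, hP, by omega, by omega, ?_⟩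
    rw [h11, h7, h3]
    exact hsec
  · rintro ⟨R, hR, _, _, κ, hP, h1, h2, h3⟩
    obtain ⟨R', h4, h5, h6⟩ := exists_longer hX ht hR h1 h2
    refine ⟨R', h4, h5 ▸ hP, ?_⟩
    rw [isSecluded_iff G l h4.nodup, h6, h5]
    exact h3

/-- Types are subsets of `X`, so there are at most 2^|X| of them, and each has at most |X| marked
vertices outside `X`. -/
theorem card_marked_le (G : SimpleGraph V) (X : Finset V) :
    (marked G X).card ≤ X.card + X.card * 2 ^ X.card := by
  have h1 : marked G X ⊆ X ∪ (marked G X \ X) := by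
    intro v; simp; tauto
  refine (Finset.card_le_card h1).trans ((Finset.card_union_le _ _).trans
    (Nat.add_le_add_left ?_ _))
  set f : V → Finset V := fun v => X.filter (G.Adj v) with hf
  have h2 : ((marked G X \ X).image f).card ≤ 2 ^ X.card := by
    rw [← Finset.card_powerset]
    refine Finset.card_le_card fun S hS => ?_
    obtain ⟨v, _, rfl⟩ := Finset.mem_image.1 hS
    exact Finset.mem_powerset.2 (Finset.filter_subset _ _)
  refine (Finset.card_le_mul_card_image (f := f) _ X.card fun S hS => ?_).trans
    (Nat.mul_le_mul_left _ h2)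
  rcases Finset.eq_empty_or_nonempty {v ∈ marked G X \ X | f v = S} with he | hne
  · simp [he]
  -- The least preferred marked vertex of the type: all others are preferred to it, and being marked
  -- it has fewer than |X| such vertices.
  · obtain ⟨v, hv, hmin⟩ := Finset.exists_min_image _ (fun v => toLex (weight G X v, v)) hne
    have hsub : ({v ∈ marked G X \ X | f v = S}.erase v) ⊆ preferred G X v := by
      intro u hu
      rw [Finset.mem_erase] at hu
      have hle := hmin u hu.2
      simp only [Finset.mem_filter, Finset.mem_sdiff] at hu hv
      simp only [preferred, Finset.mem_filter, Finset.mem_univ, true_and]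
      refine ⟨hu.2.1.2, fun x hx => ?_, ?_⟩
      · have := Finset.ext_iff.1 (hu.2.2.trans hv.2.symm) x
        simpa [hf, hx] using this
      · rw [Prod.Lex.toLex_le_toLex] at hle
        exact hle.imp_right fun h => ⟨h.1, lt_of_le_of_ne h.2 (Ne.symm hu.1)⟩
    have h3 := Finset.card_le_card hsub
    rw [Finset.card_erase_of_mem hv] at h3
    have h4 : v ∈ marked G X ∧ v ∉ X := by simpa using (Finset.mem_filter.1 hv).1
    have h5 : (preferred G X v).card < X.card := by
      simpa [marked, h4.2] using h4.1
    omega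

end TwinCover
end Secluded

/-! ### Logical connectives, quantifiers and graph predicates as terms. -/

namespace RAM

open Secluded
open scoped Classical

theorem State.var_setVar_eq {τ : State} {x i : ℕ} {y z : ℤ} (h : τ.var x = y)
    (hx : x ≠ i := by omega) : (τ.setVar i z).var x = y := by
  rw [State.setVar_var_ne _ _ hx, h]

namespace Term

/-- A test counts as true if its value is not `0`. -/
def Holds (e : Term) (τ : State) : Prop := e.eval τ ≠ 0

def and (a b : Term) : Term := ite a b (lit 0)
def or (a b : Term) : Term := ite a (lit 1) b
def not (a : Term) : Term := eq a (lit 0)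
def iff (a b : Term) : Term := eq a.not b.not
def count (i b : ℕ) (e : Term) : Term := sum i b (ite e (lit 1) (lit 0))
def ex (i b : ℕ) (e : Term) : Term := lt (lit 0) (count i b e)
def all (i b : ℕ) (e : Term) : Term := (ex i b e.not).not

section

variable {a b : Term} {τ : State}

@[simp] theorem holds_and : (and a b).Holds τ ↔ a.Holds τ ∧ b.Holds τ := by
  by_cases h : a.eval τ = 0 <;> simp [Holds, and, eval, h]

@[simp] theorem holds_or : (or a b).Holds τ ↔ a.Holds τ ∨ b.Holds τ := by
  by_cases h : a.eval τ = 0 <;> simp [Holds, or, eval, h]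

@[simp] theorem holds_not : a.not.Holds τ ↔ ¬ a.Holds τ := by
  by_cases h : a.eval τ = 0 <;> simp [Holds, not, eval, h]

@[simp] theorem holds_iff : (iff a b).Holds τ ↔ (a.Holds τ ↔ b.Holds τ) := by
  by_cases h : a.eval τ = 0 <;> by_cases h' : b.eval τ = 0 <;> simp [Holds, iff, not, eval, h, h']

@[simp] theorem holds_lt : (lt a b).Holds τ ↔ a.eval τ < b.eval τ := by
  simp [Holds, eval]

@[simp] theorem holds_eq : (eq a b).Holds τ ↔ a.eval τ = b.eval τ := by
  simp [Holds, eval]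

end

theorem eval_sum {τ : State} {b N : ℕ} (hb : τ.var b = N) (i : ℕ) (e : Term) :
    (sum i b e).eval τ = ∑ z : Fin N, e.eval (τ.setVar i (z : ℕ)) := by
  rw [eval, hb, Int.toNat_natCast, Finset.sum_range]

theorem eval_count {τ : State} {b N : ℕ} (hb : τ.var b = N) (i : ℕ) (e : Term) (P : Fin N → Prop)
    [DecidablePred P] (h : ∀ z : Fin N, e.Holds (τ.setVar i (z : ℕ)) ↔ P z) :
    (count i b e).eval τ = (Finset.univ.filter P).card := by
  rw [count, eval_sum hb, Finset.card_filter, Nat.cast_sum]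
  refine Finset.sum_congr rfl fun z _ => ?_
  by_cases hz : P z
  · have := (h z).2 hz
    simp only [Holds] at this
    simp [eval, hz, this]
  · have := mt (h z).1 hz
    simp only [Holds, not_not] at this
    simp [eval, hz, this]

theorem holds_ex {τ : State} {b N : ℕ} (hb : τ.var b = N) (i : ℕ) (e : Term) :
    (ex i b e).Holds τ ↔ ∃ z : Fin N, e.Holds (τ.setVar i (z : ℕ)) := by
  rw [ex, holds_lt, eval_count hb i e _ fun z => Iff.rfl]
  simp [eval, Finset.card_pos, Finset.filter_nonempty_iff]

theorem holds_all {τ : State} {b N : ℕ} (hb : τ.var b = N) (i : ℕ) (e : Term) :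
    (all i b e).Holds τ ↔ ∀ z : Fin N, e.Holds (τ.setVar i (z : ℕ)) := by
  rw [all, holds_not, holds_ex hb]
  simp

/-! ### The graph -/

/-- Variable `0` holds the number of vertices, array `0` the adjacency matrix of `G`, and
array `1` the indicator function of `X`. -/
structure Holding {n : ℕ} (G : SimpleGraph (Fin n)) (X : Finset (Fin n)) (τ : State) : Prop where
  size : τ.var 0 = n
  adj : ∀ u v : Fin n, τ.arr 0 (n * (u : ℕ) + (v : ℕ)) = if G.Adj u v then 1 else 0
  mem : ∀ v : Fin n, τ.arr 1 (v : ℕ) = if v ∈ X then 1 else 0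

section

variable {n : ℕ} {G : SimpleGraph (Fin n)} {X : Finset (Fin n)} {τ : State} {u v : ℕ}
  {a b : Fin n}

theorem Holding.setVar (h : Holding G X τ) {i : ℕ} {z : ℤ} (hi : 0 ≠ i := by omega) :
    Holding G X (τ.setVar i z) :=
  ⟨State.var_setVar_eq h.size, h.adj, h.mem⟩

/-- The machine does not multiply: n·u is a sum of n copies of u. Nested terms use different loop
counters, here 90, as `Scoped` requires. -/
def adjacent (u v : ℕ) : Term := get 0 (add (sum 90 0 (var u)) (var v))

def inCover (v : ℕ) : Term := get 1 (var v)

/-- The vertices `u` and `v` are adjacent, but not true twins. -/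
def nontwinEdge (u v : ℕ) : Term :=
  and (adjacent u v) (all 80 0 (or (eq (var 80) (var u)) (or (eq (var 80) (var v))
    (iff (adjacent u 80) (adjacent v 80))))).not

def sameType (u v : ℕ) : Term :=
  all 84 0 (or (inCover 84).not (iff (adjacent u 84) (adjacent v 84)))

def leader (v : ℕ) : Term :=
  and (inCover v).not (all 82 0 (or (inCover 82) (or (adjacent 82 v).not (lt (var 82) (var v)).not)))

def cliqueSize (v : ℕ) : Term :=
  count 82 0 (and (inCover 82).not (or (eq (var 82) (var v)) (adjacent 82 v)))

def weight (v : ℕ) : Term := ite (leader v) (cliqueSize v) (lit 0)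

def preferred (u v : ℕ) : Term :=
  and (inCover u).not (and (sameType u v) (or (lt (weight v) (weight u))
    (and (eq (weight v) (weight u)) (lt (var v) (var u)))))

/-- Variable `5` is meant to hold |X|. -/
def isMarked (v : ℕ) : Term := or (inCover v) (lt (count 86 0 (preferred 86 v)) (var 5))

/-- The number of marked vertices before `v`. -/
def rank (v : ℕ) : Term := count 88 0 (and (lt (var 88) (var v)) (isMarked 88))

theorem holds_adjacent (h : Holding G X τ) (ha : τ.var u = (a : ℕ)) (hb : τ.var v = (b : ℕ))
    (hu : u ≠ 90 := by omega) : (adjacent u v).Holds τ ↔ G.Adj a b := by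
  have : (adjacent u v).eval τ = if G.Adj a b then 1 else 0 := by
    rw [← h.adj, adjacent, eval, eval, eval_sum h.size]
    simp [eval, State.setVar_var_ne _ _ hu, ha, hb]
  rw [Holds, this]
  split_ifs with hab <;> simp [hab]

theorem holds_inCover (h : Holding G X τ) (ha : τ.var v = (a : ℕ)) :
    (inCover v).Holds τ ↔ a ∈ X := by
  rw [Holds, inCover, eval, eval, ha, h.mem]
  split_ifs with hab <;> simp [hab]

theorem holds_nontwinEdge (h : Holding G X τ) (ha : τ.var u = (a : ℕ)) (hb : τ.var v = (b : ℕ))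
    (hu : u < 80) (hv : v < 80) :
    (nontwinEdge u v).Holds τ ↔ G.Adj a b ∧ ¬ AreTrueTwins G a b := by
  rw [nontwinEdge, holds_and, holds_not, holds_adjacent h ha hb, holds_all h.size, AreTrueTwins]
  refine and_congr_right fun hab => not_congr ?_
  rw [and_iff_right hab, Set.ext_iff]
  refine forall_congr' fun x => ?_
  have h1 := State.var_setVar_eq (z := ((x : ℕ) : ℤ)) (i := 80) ha
  have h2 := State.var_setVar_eq (z := ((x : ℕ) : ℤ)) (i := 80) hb
  have h3 := State.setVar_var_same τ 80 (x : ℕ)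
  rw [holds_or, holds_or, holds_iff, holds_adjacent h.setVar h1 h3, holds_adjacent h.setVar h2 h3,
    holds_eq, holds_eq]
  simp only [eval, h1, h2, h3, Nat.cast_inj, Fin.val_inj, Set.mem_sdiff, SimpleGraph.mem_neighborSet,
    Set.mem_singleton_iff]
  by_cases hxa : x = a
  · simp [hxa]
  · by_cases hxb : x = b
    · simp [hxb]
    · simp [hxa, hxb]

theorem holds_sameType (h : Holding G X τ) (ha : τ.var u = (a : ℕ)) (hb : τ.var v = (b : ℕ))
    (hu : u < 90) (hv : v < 90) (hu' : u ≠ 84) (hv' : v ≠ 84) :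
    (sameType u v).Holds τ ↔ SameType G X a b := by
  rw [sameType, holds_all h.size]
  refine forall_congr' fun x => ?_
  have h1 := State.var_setVar_eq (z := ((x : ℕ) : ℤ)) (i := 84) ha
  have h2 := State.var_setVar_eq (z := ((x : ℕ) : ℤ)) (i := 84) hb
  have h3 := State.setVar_var_same τ 84 (x : ℕ)
  rw [holds_or, holds_not, holds_iff, holds_adjacent h.setVar h1 h3, holds_adjacent h.setVar h2 h3,
    holds_inCover h.setVar h3, imp_iff_not_or]

theorem holds_leader (h : Holding G X τ) (ha : τ.var v = (a : ℕ)) (hv : v ≠ 82) :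
    (leader v).Holds τ ↔ IsLeader G X a := by
  rw [leader, holds_and, holds_not, holds_inCover h ha, holds_all h.size]
  refine and_congr_right fun _ => forall_congr' fun x => ?_
  have h1 := State.var_setVar_eq (z := ((x : ℕ) : ℤ)) (i := 82) ha
  have h3 := State.setVar_var_same τ 82 (x : ℕ)
  rw [holds_or, holds_or, holds_not, holds_not, holds_inCover h.setVar h3,
    holds_adjacent h.setVar h3 h1, holds_lt]
  simp only [eval, h1, h3, Nat.cast_lt, Fin.val_fin_lt]
  tauto

theorem eval_weight (h : Holding G X τ) (ha : τ.var v = (a : ℕ)) (hv : v ≠ 82) :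
    (weight v).eval τ = Secluded.weight G X a := by
  have h1 : (cliqueSize v).eval τ = (clique G X a).card := by
    refine eval_count h.size _ _ _ fun x => ?_
    have h1 := State.var_setVar_eq (z := ((x : ℕ) : ℤ)) (i := 82) ha
    have h3 := State.setVar_var_same τ 82 (x : ℕ)
    rw [holds_and, holds_or, holds_not, holds_inCover h.setVar h3,
      holds_adjacent h.setVar h3 h1, holds_eq]
    simp only [eval, h1, h3, Nat.cast_inj, Fin.val_inj]
  have h2 := holds_leader h ha hv
  rw [Holds] at h2
  rw [weight, eval, h1, Secluded.weight]
  simp only [h2, eval]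
  split_ifs <;> rfl

theorem holds_preferred (h : Holding G X τ) (ha : τ.var u = (a : ℕ)) (hb : τ.var v = (b : ℕ))
    (hu : u < 90) (hv : v < 90) (hu' : u ≠ 84 ∧ u ≠ 82) (hv' : v ≠ 84 ∧ v ≠ 82) :
    (preferred u v).Holds τ ↔ a ∈ Secluded.preferred G X b := by
  rw [preferred, holds_and, holds_not, holds_inCover h ha, holds_and,
    holds_sameType h ha hb hu hv hu'.1 hv'.1, holds_or, holds_and, holds_lt, holds_eq, holds_lt,
    eval_weight h ha hu'.2, eval_weight h hb hv'.2]
  simp [Secluded.preferred, eval, ha, hb]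

theorem holds_isMarked (h : Holding G X τ) (hq : τ.var 5 = X.card) (ha : τ.var v = (a : ℕ))
    (hv : v < 90) (hv' : v ≠ 82 ∧ v ≠ 84 ∧ v ≠ 86) :
    (isMarked v).Holds τ ↔ a ∈ marked G X := by
  rw [isMarked, holds_or, holds_inCover h ha, holds_lt,
    eval_count h.size _ _ (fun x => x ∈ Secluded.preferred G X a)]
  · simp [marked, eval, hq]
  · intro x
    exact holds_preferred h.setVar (State.setVar_var_same _ _ _) (State.var_setVar_eq ha)
      (by omega) hv (by omega) (by omega)

theorem eval_rank (h : Holding G X τ) (hq : τ.var 5 = X.card) (ha : τ.var v = (a : ℕ))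
    (hv : v < 82) :
    (rank v).eval τ = (Finset.univ.filter fun x => x < a ∧ x ∈ marked G X).card := by
  refine eval_count h.size _ _ _ fun x => ?_
  rw [holds_and, holds_isMarked h.setVar (State.var_setVar_eq hq) (State.setVar_var_same _ _ _)
    (by omega) (by omega), holds_lt]
  simp [eval, State.setVar_var_ne _ _ (show v ≠ 88 by omega), ha]

end

/-! ### Codes of vertex sequences -/

/-- The quotient of the variable `x` by the variable `6`. -/
def quotient (x : ℕ) : Term :=
  count 70 8 (lt (var x) (sum 72 6 (add (var 70) (lit 1)))).not

/-- The variable `c` with its last `i + o` digits removed, where the base is the variable `6`. -/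
def shift (c i o : ℕ) : Term :=
  fold 60 7 (var c) (ite (lt (var 60) (add (var i) (lit o))) (quotient 61) (var 61))

/-- The remainder as y − m·⌊y/m⌋, the product again being a sum of m copies. -/
def digit (c i o : ℕ) : Term := sub (shift c i o) (sum 74 6 (shift c i (o + 1)))

/-- The vertex `v` is encoded at position `i + o` of the code `c`. -/
def codes (c i o v : ℕ) : Term := and (isMarked v) (eq (rank v) (digit c i o))

section

variable {τ : State} {m L C : ℕ}

/-- The quotient y/m is the number of z with m·(z + 1) ≤ y; since y ≤ C, all of these are below the
loop bound. -/
theorem eval_quotient (hm : τ.var 6 = m) (hC : τ.var 8 = C) (hm0 : 0 < m) {x y : ℕ}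
    (hx : τ.var x = y) (hx' : x < 70) (hy : y ≤ C) : (quotient x).eval τ = (y / m : ℕ) := by
  rw [quotient, eval_count hC _ _ (fun z => (z : ℕ) < y / m)]
  · rw [Fin.card_filter_val_lt, min_eq_right ((Nat.div_le_self _ _).trans hy)]
  · intro z
    rw [holds_not, holds_lt, eval_sum (N := m) (State.var_setVar_eq hm)]
    simp only [eval, State.setVar_var_ne _ _ (show 70 ≠ 72 by omega), State.setVar_var_same,
      Finset.sum_const, Finset.card_univ, Fintype.card_fin, nsmul_eq_mul,
      State.setVar_var_ne _ _ (show x ≠ 70 by omega), hx]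
    rw [← Nat.succ_le_iff, Nat.le_div_iff_mul_le hm0, not_lt, ← Nat.cast_succ, ← Nat.cast_mul, Nat.cast_le, mul_comm]

theorem eval_shift (hm : τ.var 6 = m) (hL : τ.var 7 = L) (hC : τ.var 8 = C) (hm0 : 0 < m)
    {c i o x y : ℕ} (hc : τ.var c = x) (hi : τ.var i = y) (hi' : i < 60) (hx : x ≤ C)
    (hy : y + o ≤ L) : (shift c i o).eval τ = (x / m ^ (y + o) : ℕ) := by
  rw [shift, eval, hL, Int.toNat_natCast]
  -- The loop always runs L rounds, as its bound must be a register, but it divides only in the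
  -- first y + o rounds. Hence the exponent min z (y + o).
  have key : ∀ z : ℕ, (Nat.rec ((var c).eval τ) (fun z a => (ite (lt (var 60) (add (var i) (lit o)))
      (quotient 61) (var 61)).eval ((τ.setVar 60 z).setVar (60 + 1) a)) z : ℤ) =
      (x / m ^ min z (y + o) : ℕ) := by
    intro z
    induction z with
    | zero => simp [eval, hc]
    | succ z ih =>
      simp only [ih]
      rw [eval, eval_quotient (y := x / m ^ min z (y + o)) (State.var_setVar_eq
        (State.var_setVar_eq hm)) (State.var_setVar_eq (State.var_setVar_eq hC)) hm0
        (State.setVar_var_same _ _ _) (by omega) ((Nat.div_le_self _ _).trans hx)]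
      have h1 : ((lt (var 60) (add (var i) (lit o))).eval
          ((τ.setVar 60 z).setVar (60 + 1) ((x / m ^ min z (y + o) : ℕ) : ℤ)) ≠ 0) ↔ z < y + o := by
        rw [← Holds, holds_lt]
        simp only [eval]
        rw [State.setVar_var_ne _ _ (by omega), State.setVar_var_same,
          State.var_setVar_eq (State.var_setVar_eq hi), ← Nat.cast_add, Nat.cast_lt]
      simp only [h1]
      split_ifs with h
      · rw [Nat.div_div_eq_div_mul, ← pow_succ]
        congr 3
        omega
      · rw [eval, State.setVar_var_same, min_eq_right (by omega), min_eq_right (by omega)]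
  rw [key L, min_eq_right hy]

theorem eval_digit (hm : τ.var 6 = m) (hL : τ.var 7 = L) (hC : τ.var 8 = C) (hm0 : 0 < m)
    {c i o x y : ℕ} (hc : τ.var c = x) (hc' : c < 60) (hi : τ.var i = y) (hi' : i < 60)
    (hx : x ≤ C) (hy : y + o < L) : (digit c i o).eval τ = (x / m ^ (y + o) % m : ℕ) := by
  rw [digit, eval, eval_shift hm hL hC hm0 hc hi hi' hx hy.le, eval_sum hm]
  have : ∀ z : ℕ, (shift c i (o + 1)).eval (τ.setVar 74 z) = (x / m ^ (y + o + 1) : ℕ) := fun z =>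
    eval_shift (State.var_setVar_eq hm) (State.var_setVar_eq hL) (State.var_setVar_eq hC) hm0
      (State.var_setVar_eq hc) (State.var_setVar_eq hi) hi' hx hy
  simp only [this, Finset.sum_const, Finset.card_univ, Fintype.card_fin, nsmul_eq_mul]
  have h := Nat.div_add_mod (x / m ^ (y + o)) m
  rw [Nat.div_div_eq_div_mul, ← pow_succ] at h
  rw [sub_eq_iff_eq_add, ← Nat.cast_mul, ← Nat.cast_add, Nat.cast_inj]
  omega

/-- The vertex `v` is encoded at position `i` of the code `c`. -/
def Codes {n : ℕ} (G : SimpleGraph (Fin n)) (X : Finset (Fin n)) (c i : ℕ) (v : Fin n) : Prop :=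
  v ∈ marked G X ∧ (Finset.univ.filter fun x => x < v ∧ x ∈ marked G X).card =
    c / (marked G X).card ^ i % (marked G X).card

/-- The registers needed to work with codes. -/
structure Prepared {n : ℕ} (G : SimpleGraph (Fin n)) (X : Finset (Fin n)) (τ : State) : Prop
    extends Holding G X τ where
  cover : τ.var 5 = X.card
  base : τ.var 6 = (marked G X).card
  length : τ.var 7 = (2 * X.card : ℕ)
  bound : τ.var 8 = ((marked G X).card ^ (2 * X.card) : ℕ)

variable {n : ℕ} {G : SimpleGraph (Fin n)} {X : Finset (Fin n)}

theorem Prepared.setVar (h : Prepared G X τ) {i : ℕ} {z : ℤ} (hi : 9 ≤ i := by omega) :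
    Prepared G X (τ.setVar i z) :=
  ⟨h.toHolding.setVar, State.var_setVar_eq h.cover, State.var_setVar_eq h.base,
    State.var_setVar_eq h.length, State.var_setVar_eq h.bound⟩

theorem holds_codes (h : Prepared G X τ) (hm0 : 0 < (marked G X).card) {c i o v x y : ℕ}
    {a : Fin n} (hc : τ.var c = x) (hc' : c < 60) (hi : τ.var i = y) (hi' : i < 60)
    (hv : τ.var v = (a : ℕ)) (hv' : v < 82) (hx : x < (marked G X).card ^ (2 * X.card))
    (hy : y + o < 2 * X.card) : (codes c i o v).Holds τ ↔ Codes G X x (y + o) a := by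
  rw [codes, holds_and, holds_isMarked h.toHolding h.cover hv (by omega) (by omega), holds_eq,
    eval_rank h.toHolding h.cover hv hv',
    eval_digit h.base h.length h.bound hm0 hc hc' hi hi' hx.le hy, Nat.cast_inj, Codes]

/-- The rank is strictly increasing on marked vertices, so a digit determines its vertex. -/
theorem Codes.unique {c i : ℕ} {u v : Fin n} (hu : Codes G X c i u) (hv : Codes G X c i v) :
    u = v := by
  have key : ∀ {u v : Fin n}, u ∈ marked G X → u < v →
      (Finset.univ.filter fun x => x < u ∧ x ∈ marked G X).card <
      (Finset.univ.filter fun x => x < v ∧ x ∈ marked G X).card := by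
    intro u v hu huv
    refine Finset.card_lt_card ⟨fun w hw => ?_, fun h => ?_⟩
    · simp only [Finset.mem_filter, Finset.mem_univ, true_and] at hw ⊢
      exact ⟨hw.1.trans huv, hw.2⟩
    · have := h (show u ∈ _ by simp [hu, huv])
      simp at this
  have h := hu.2.trans hv.2.symm
  rcases lt_trichotomy u v with h' | h' | h'
  · exact absurd (key hu.1 h') (by omega)
  · exact h'
  · exact absurd (key hv.1 h') (by omega)

/-- Numbers in base `m`, with the least significant digit first. -/
theorem exists_digits {m : ℕ} (ds : List ℕ) (hds : ∀ d ∈ ds, d < m) :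
    ∃ c < m ^ ds.length, ∀ (i : ℕ) (hi : i < ds.length), c / m ^ i % m = ds[i] := by
  induction ds with
  | nil => exact ⟨0, by simp, by simp⟩
  | cons d ds ih =>
    obtain ⟨c, hc, h⟩ := ih fun d hd => hds d (by simp [hd])
    have hd := hds d (by simp)
    refine ⟨d + m * c, ?_, fun i hi => ?_⟩
    · rw [List.length_cons, pow_succ, mul_comm (m ^ _)]
      have := Nat.mul_le_mul_left m (Nat.succ_le_of_lt hc)
      rw [Nat.mul_succ] at this
      omega
    · cases i with
      | zero => simp [Nat.add_mul_mod_self_left, Nat.mod_eq_of_lt hd]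
      | succ i =>
        have h1 : (d + m * c) / m = c := by
          rw [Nat.add_mul_div_left _ _ (by omega), Nat.div_eq_of_lt hd, zero_add]
        rw [pow_succ', ← Nat.div_div_eq_div_mul, h1]
        simpa using h i (by simpa using hi)

/-- Every sequence of marked vertices has a code. -/
theorem exists_code {R : List (Fin n)} (hR : ∀ v ∈ R, v ∈ marked G X) :
    ∃ c < (marked G X).card ^ R.length, ∀ (i : ℕ) (hi : i < R.length), Codes G X c i R[i] := by
  set f : Fin n → ℕ := fun v => (Finset.univ.filter fun x => x < v ∧ x ∈ marked G X).card with hf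
  obtain ⟨c, hc, h⟩ := exists_digits (m := (marked G X).card) (R.map f) (by
    intro d hd
    obtain ⟨v, hv, rfl⟩ := List.mem_map.1 hd
    -- Ranks are valid digits: `v` is marked but not counted in its own rank.
    refine Finset.card_lt_card ⟨fun w hw => (Finset.mem_filter.1 hw).2.2, fun h => ?_⟩
    have := h (hR v hv)
    simp at this)
  rw [List.length_map] at hc
  refine ⟨c, hc, fun i hi => ⟨hR _ (List.getElem_mem hi), ?_⟩⟩
  rw [h i (by simpa using hi), List.getElem_map]

/-! ### The test of a code -/

/-- The vertex `v` is among the first entries, up to position `11`, of the code `10`. -/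
def onPath (v : ℕ) : Term := ex 20 7 (and (lt (var 11) (var 20)).not (codes 10 20 0 v))

/-- In the first test the quantifier merely supplies a variable with value 0, since `codes` takes
its position from a variable. Variables `1` and `2` hold s and t, and `11` the last position. -/
def pathTest : Term :=
  and (ex 12 7 (and (eq (var 12) (lit 0)) (codes 10 12 0 1)))
    (and (codes 10 11 0 2)
      (and (all 12 7 (or (lt (var 12) (var 11)).not (ex 13 0 (ex 14 0 (and (adjacent 13 14)
          (and (codes 10 12 0 13) (codes 10 12 1 14)))))))
        (ex 12 7 (ex 13 7 (ex 14 0 (and (lt (var 12) (var 13)) (and (lt (var 11) (var 13)).not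
          (and (codes 10 12 0 14) (codes 10 13 0 14))))))).not))

def extensionSize : Term :=
  count 15 0 (or (onPath 15) (and (inCover 15).not
    (ex 16 0 (and (onPath 16) (and (inCover 16).not (adjacent 16 15))))))

def neighborhoodSize : Term :=
  count 15 0 (or (onPath 15) (ex 16 0 (and (onPath 16) (adjacent 16 15))))

/-- The answer, where `r` tests whether the variable `17` plus one is a length to look for. -/
def answer (r : Term) : Term :=
  ex 10 8 (ex 11 7 (and pathTest (ex 17 0 (and r (and (lt (var 17) (var 11)).not
    (and (lt (var 17) extensionSize)
      (lt (add (var 4) (add (var 17) (lit 1))) neighborhoodSize).not))))))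

/-- The first entries of the code `c`, up to position `r`, are the list `R`. -/
structure Represents (G : SimpleGraph (Fin n)) (X : Finset (Fin n)) (c r : ℕ)
    (R : List (Fin n)) : Prop where
  length : R.length = r + 1
  codes : ∀ (i : ℕ) (hi : i < R.length), Codes G X c i R[i]

variable {c r : ℕ} {R : List (Fin n)} {s t : Fin n}

theorem Represents.iff_getElem (hR : Represents G X c r R) {i : ℕ} (hi : i ≤ r) (v : Fin n) :
    Codes G X c i v ↔ v = R[i]'(by rw [hR.length]; omega) := by
  have h := hR.codes i (by rw [hR.length]; omega)
  exact ⟨fun h' => h'.unique h, fun h' => h' ▸ h⟩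

theorem holds_onPath (h : Prepared G X τ) (hm0 : 0 < (marked G X).card) (hc : τ.var 10 = c)
    (hr : τ.var 11 = r) (hcC : c < (marked G X).card ^ (2 * X.card)) (hrL : r < 2 * X.card)
    (hR : Represents G X c r R) {v : ℕ} {a : Fin n} (ha : τ.var v = (a : ℕ)) (hv : v < 20) :
    (onPath v).Holds τ ↔ a ∈ R := by
  rw [onPath, holds_ex h.length, List.mem_iff_getElem]
  have key : ∀ i : Fin (2 * X.card), (and (lt (var 11) (var 20)).not (codes 10 20 0 v)).Holds
      (τ.setVar 20 (i : ℕ)) ↔ (i : ℕ) ≤ r ∧ Codes G X c i a := by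
    intro i
    rw [holds_and, holds_not, holds_lt, holds_codes h.setVar hm0 (State.var_setVar_eq hc)
      (by omega) (State.setVar_var_same _ _ _) (by omega) (State.var_setVar_eq ha) (by omega)
      hcC (by omega), add_zero]
    simp only [eval, State.setVar_var_same, State.setVar_var_ne _ _ (show 11 ≠ 20 by omega), hr,
      Nat.cast_lt, not_lt]
  simp only [key]
  constructor
  · rintro ⟨i, hi, h⟩
    exact ⟨i, by rw [hR.length]; omega, ((hR.iff_getElem hi a).1 h).symm⟩
  · rintro ⟨i, hi, h⟩
    rw [hR.length] at hi
    exact ⟨⟨i, by omega⟩, show i ≤ r by omega, (hR.iff_getElem (i := i) (by omega) a).2 h.symm⟩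

theorem holds_pathTest (h : Prepared G X τ) (hm0 : 0 < (marked G X).card) (hc : τ.var 10 = c)
    (hr : τ.var 11 = r) (hcC : c < (marked G X).card ^ (2 * X.card)) (hrL : r < 2 * X.card)
    (hs : τ.var 1 = (s : ℕ)) (ht : τ.var 2 = (t : ℕ)) :
    pathTest.Holds τ ↔ Codes G X c 0 s ∧ Codes G X c r t ∧
      (∀ i < r, ∃ u v, G.Adj u v ∧ Codes G X c i u ∧ Codes G X c (i + 1) v) ∧
      ∀ i j v, i < j → j ≤ r → Codes G X c i v → ¬ Codes G X c j v := by
  rw [pathTest, holds_and, holds_and, holds_and, holds_not, holds_ex h.length, holds_all h.length,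
    holds_ex h.length, holds_codes h hm0 hc (by omega) hr (by omega) ht (by omega) hcC (by omega),
    add_zero]
  refine and_congr ?_ (and_congr_right fun _ => and_congr ?_ ?_)
  · have key : ∀ i : Fin (2 * X.card), (and (eq (var 12) (lit 0)) (codes 10 12 0 1)).Holds
        (τ.setVar 12 (i : ℕ)) ↔ (i : ℕ) = 0 ∧ Codes G X c i s := by
      intro i
      rw [holds_and, holds_eq, holds_codes h.setVar hm0 (State.var_setVar_eq hc)
        (by omega) (State.setVar_var_same _ _ _) (by omega) (State.var_setVar_eq hs) (by omega)
        hcC (by omega), add_zero]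
      simp only [eval, State.setVar_var_same, Nat.cast_eq_zero]
    simp only [key]
    constructor
    · rintro ⟨i, hi, h⟩
      exact hi ▸ h
    · intro h
      exact ⟨⟨0, by omega⟩, rfl, h⟩
  · have key : ∀ i : Fin (2 * X.card), (or (lt (var 12) (var 11)).not (ex 13 0 (ex 14 0
        (and (adjacent 13 14) (and (codes 10 12 0 13) (codes 10 12 1 14)))))).Holds
        (τ.setVar 12 (i : ℕ)) ↔
        ((i : ℕ) < r → ∃ u v, G.Adj u v ∧ Codes G X c i u ∧ Codes G X c (i + 1) v) := by
      intro i
      rw [holds_or, holds_not, holds_lt, holds_ex (State.var_setVar_eq h.size), imp_iff_not_or]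
      simp only [eval, State.setVar_var_same, State.setVar_var_ne _ _ (show 11 ≠ 12 by omega), hr,
        Nat.cast_lt]
      by_cases hir : (i : ℕ) < r
      · refine or_congr Iff.rfl (exists_congr fun u => ?_)
        rw [holds_ex (State.var_setVar_eq (State.var_setVar_eq h.size))]
        refine exists_congr fun v => ?_
        have h12 : (((τ.setVar 12 (i : ℕ)).setVar 13 (u : ℕ)).setVar 14 (v : ℕ)).var 12 = (i : ℕ) :=
          State.var_setVar_eq (State.var_setVar_eq (State.setVar_var_same _ _ _))
        have h13 : (((τ.setVar 12 (i : ℕ)).setVar 13 (u : ℕ)).setVar 14 (v : ℕ)).var 13 = (u : ℕ) :=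
          State.var_setVar_eq (State.setVar_var_same _ _ _)
        have h14 := State.setVar_var_same ((τ.setVar 12 (i : ℕ)).setVar 13 (u : ℕ)) 14 (v : ℕ)
        have h10 : (((τ.setVar 12 (i : ℕ)).setVar 13 (u : ℕ)).setVar 14 (v : ℕ)).var 10 = c :=
          State.var_setVar_eq (State.var_setVar_eq (State.var_setVar_eq hc))
        rw [holds_and, holds_and, holds_adjacent h.setVar.setVar.setVar.toHolding h13 h14,
          holds_codes h.setVar.setVar.setVar hm0 h10 (by omega) h12 (by omega) h13 (by omega) hcC
            (by omega),
          holds_codes h.setVar.setVar.setVar hm0 h10 (by omega) h12 (by omega) h14 (by omega) hcC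
            (by omega), add_zero]
      · exact iff_of_true (.inl hir) (.inl hir)
    simp only [key]
    exact ⟨fun h i hi => h ⟨i, by omega⟩ hi, fun h i hi => h i hi⟩
  · have key : ∀ (i j : Fin (2 * X.card)) (v : Fin n), (and (lt (var 12) (var 13))
        (and (lt (var 11) (var 13)).not (and (codes 10 12 0 14) (codes 10 13 0 14)))).Holds
        (((τ.setVar 12 (i : ℕ)).setVar 13 (j : ℕ)).setVar 14 (v : ℕ)) ↔
        (i : ℕ) < j ∧ (j : ℕ) ≤ r ∧ Codes G X c i v ∧ Codes G X c j v := by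
      intro i j v
      have h12 : (((τ.setVar 12 (i : ℕ)).setVar 13 (j : ℕ)).setVar 14 (v : ℕ)).var 12 = (i : ℕ) :=
        State.var_setVar_eq (State.var_setVar_eq (State.setVar_var_same _ _ _))
      have h13 : (((τ.setVar 12 (i : ℕ)).setVar 13 (j : ℕ)).setVar 14 (v : ℕ)).var 13 = (j : ℕ) :=
        State.var_setVar_eq (State.setVar_var_same _ _ _)
      have h14 := State.setVar_var_same ((τ.setVar 12 (i : ℕ)).setVar 13 (j : ℕ)) 14 (v : ℕ)
      have h10 : (((τ.setVar 12 (i : ℕ)).setVar 13 (j : ℕ)).setVar 14 (v : ℕ)).var 10 = c :=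
        State.var_setVar_eq (State.var_setVar_eq (State.var_setVar_eq hc))
      have h11 : (((τ.setVar 12 (i : ℕ)).setVar 13 (j : ℕ)).setVar 14 (v : ℕ)).var 11 = r :=
        State.var_setVar_eq (State.var_setVar_eq (State.var_setVar_eq hr))
      rw [holds_and, holds_and, holds_and, holds_not, holds_lt, holds_lt,
        holds_codes h.setVar.setVar.setVar hm0 h10 (by omega) h12 (by omega) h14 (by omega) hcC
          (by omega),
        holds_codes h.setVar.setVar.setVar hm0 h10 (by omega) h13 (by omega) h14 (by omega) hcC
          (by omega)]
      simp only [eval, h11, h12, h13, Nat.cast_lt, not_lt, add_zero]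
    have hsize : ∀ i j : Fin (2 * X.card), ((τ.setVar 12 (i : ℕ)).setVar 13 (j : ℕ)).var 0 = n :=
      fun i j => State.var_setVar_eq (State.var_setVar_eq h.size)
    have hlen : ∀ i : Fin (2 * X.card), (τ.setVar 12 (i : ℕ)).var 7 = (2 * X.card : ℕ) :=
      fun i => State.var_setVar_eq h.length
    simp only [holds_ex (hlen _), holds_ex (hsize _ _), key]
    constructor
    · intro h i j v hij hj hi hj'
      exact h ⟨⟨i, by omega⟩, ⟨j, by omega⟩, v, hij, hj, hi, hj'⟩
    · rintro h ⟨i, j, v, hij, hj, hi, hj'⟩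
      exact h i j v hij hj hi hj'

/-- Each position up to `r` codes a vertex: the edge condition provides one below `r`, and t is the
one at `r`. By `Codes.unique` it is the only one, so the four conditions are those for a path list.
-/
theorem pathTest_iff :
    (Codes G X c 0 s ∧ Codes G X c r t ∧
      (∀ i < r, ∃ u v, G.Adj u v ∧ Codes G X c i u ∧ Codes G X c (i + 1) v) ∧
      ∀ i j v, i < j → j ≤ r → Codes G X c i v → ¬ Codes G X c j v) ↔
    ∃ R, Represents G X c r R ∧ IsPathList G s t R := by
  constructor
  · rintro ⟨h1, h2, h3, h4⟩
    have hex : ∀ i, ∃ v, i ≤ r → Codes G X c i v := by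
      intro i
      by_cases hi : i < r
      · obtain ⟨u, v, _, hu, _⟩ := h3 i hi
        exact ⟨u, fun _ => hu⟩
      · exact ⟨t, fun h => by rwa [show i = r by omega]⟩
    choose f hf using hex
    have hget : ∀ (i : ℕ) (hi : i < (List.ofFn fun i : Fin (r + 1) => f i).length),
        (List.ofFn fun i : Fin (r + 1) => f i)[i] = f i := fun i hi => by rw [List.getElem_ofFn]
    refine ⟨List.ofFn fun i : Fin (r + 1) => f i, ⟨by simp, fun i hi => ?_⟩, ?_, ?_, ?_, ?_⟩
    · rw [hget]
      exact hf i (by simp at hi; omega)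
    · rw [List.nodup_ofFn]
      have key : ∀ i j : Fin (r + 1), i < j → f i ≠ f j := fun i j hij he =>
        h4 i j (f i) hij (by omega) (hf i (by omega)) (he ▸ hf j (by omega))
      intro i j hij
      rcases lt_trichotomy i j with h | h | h
      · exact absurd hij (key i j h)
      · exact h
      · exact absurd hij.symm (key j i h)
    · rw [List.isChain_iff_getElem]
      intro i hi
      rw [hget, hget]
      simp only [List.length_ofFn] at hi
      obtain ⟨u, v, huv, hu, hv⟩ := h3 i (by omega)
      rwa [(hf i (by omega)).unique hu, (hf (i + 1) (by omega)).unique hv]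
    · rw [List.head?_eq_getElem?, List.getElem?_eq_getElem (by simp), hget,
        (hf 0 (by omega)).unique h1]
    · rw [List.getLast?_eq_getElem?, List.getElem?_eq_getElem (by simp), hget, List.length_ofFn,
        Nat.add_sub_cancel, (hf r le_rfl).unique h2]
  · rintro ⟨R, hR, hP⟩
    have hlen := hR.length
    refine ⟨?_, ?_, fun i hi => ?_, fun i j v hij hj h h' => ?_⟩
    · rw [hR.iff_getElem (by omega)]
      have h := hP.head
      rw [List.head?_eq_getElem?, List.getElem?_eq_getElem (by omega), Option.some_inj] at h
      exact h.symm
    · rw [hR.iff_getElem le_rfl]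
      have h := hP.last
      rw [List.getLast?_eq_getElem?, List.getElem?_eq_getElem (by omega), Option.some_inj] at h
      simp only [hlen, Nat.add_sub_cancel] at h
      exact h.symm
    · have h := List.isChain_iff_getElem.1 hP.chain i (by omega)
      exact ⟨_, _, h, hR.codes i (by omega), hR.codes (i + 1) (by omega)⟩
    · rw [hR.iff_getElem (by omega)] at h h'
      have := (hP.nodup.getElem_inj_iff).1 (h.symm.trans h')
      omega

theorem eval_extensionSize (h : Prepared G X τ) (hm0 : 0 < (marked G X).card) (hc : τ.var 10 = c)
    (hr : τ.var 11 = r) (hcC : c < (marked G X).card ^ (2 * X.card)) (hrL : r < 2 * X.card)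
    (hR : Represents G X c r R) : extensionSize.eval τ = (extension G X R).card := by
  rw [extensionSize, eval_count h.size _ _ (fun v => v ∈ extension G X R), Finset.filter_univ_mem]
  intro v
  simp only [extension, Finset.mem_filter, Finset.mem_univ, true_and]
  have h15 := State.setVar_var_same τ 15 (v : ℕ)
  rw [holds_or, holds_and, holds_not, holds_inCover h.setVar.toHolding h15,
    holds_ex (State.var_setVar_eq h.size), holds_onPath h.setVar hm0 (State.var_setVar_eq hc)
      (State.var_setVar_eq hr) hcC hrL hR h15 (by omega)]
  refine or_congr Iff.rfl (and_congr_right fun _ => exists_congr fun u => ?_)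
  have h16 := State.setVar_var_same (τ.setVar 15 (v : ℕ)) 16 (u : ℕ)
  rw [holds_and, holds_and, holds_not, holds_inCover h.setVar.setVar.toHolding h16,
    holds_onPath h.setVar.setVar hm0 (State.var_setVar_eq (State.var_setVar_eq hc))
      (State.var_setVar_eq (State.var_setVar_eq hr)) hcC hrL hR h16 (by omega),
    holds_adjacent h.setVar.setVar.toHolding h16 (State.var_setVar_eq h15)]

theorem eval_neighborhoodSize (h : Prepared G X τ) (hm0 : 0 < (marked G X).card)
    (hc : τ.var 10 = c) (hr : τ.var 11 = r) (hcC : c < (marked G X).card ^ (2 * X.card))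
    (hrL : r < 2 * X.card) (hR : Represents G X c r R) :
    neighborhoodSize.eval τ = (closedNeighborhood G R).card := by
  rw [neighborhoodSize, eval_count h.size _ _ (fun v => v ∈ closedNeighborhood G R), Finset.filter_univ_mem]
  intro v
  simp only [closedNeighborhood, Finset.mem_filter, Finset.mem_univ, true_and]
  have h15 := State.setVar_var_same τ 15 (v : ℕ)
  rw [holds_or, holds_ex (State.var_setVar_eq h.size), holds_onPath h.setVar hm0
    (State.var_setVar_eq hc) (State.var_setVar_eq hr) hcC hrL hR h15 (by omega)]
  refine or_congr Iff.rfl (exists_congr fun u => ?_)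
  have h16 := State.setVar_var_same (τ.setVar 15 (v : ℕ)) 16 (u : ℕ)
  rw [holds_and, holds_onPath h.setVar.setVar hm0 (State.var_setVar_eq (State.var_setVar_eq hc))
      (State.var_setVar_eq (State.var_setVar_eq hr)) hcC hrL hR h16 (by omega),
    holds_adjacent h.setVar.setVar.toHolding h16 (State.var_setVar_eq h15)]

/-- On a twin cover containing `s` and `t` the final test is correct. -/
theorem holds_answer (h : Prepared G X τ) (hX : IsTwinCover G (X : Set (Fin n))) (hsX : s ∈ X)
    (htX : t ∈ X) (hs : τ.var 1 = (s : ℕ)) (ht : τ.var 2 = (t : ℕ)) {e : Term} {P : ℕ → Prop}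
    (he : ∀ υ : State, υ.var 3 = τ.var 3 → ∀ z : ℕ, υ.var 17 = z → (e.Holds υ ↔ P (z + 1))) :
    (answer e).Holds τ ↔
      ∃ R, IsPathList G s t R ∧ P R.length ∧ IsSecluded G (τ.var 4) {v | v ∈ R} := by
  have hm0 : 0 < (marked G X).card := Finset.card_pos.2 ⟨s, by simp [marked, hsX]⟩
  rw [exists_secluded_iff hX hsX htX, answer, holds_ex h.bound]
  have key : ∀ (c : Fin ((marked G X).card ^ (2 * X.card))) (r : Fin (2 * X.card)),
      (and pathTest (ex 17 0 (and e (and (lt (var 17) (var 11)).not (and (lt (var 17) extensionSize)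
      (lt (add (var 4) (add (var 17) (lit 1))) neighborhoodSize).not))))).Holds
        ((τ.setVar 10 (c : ℕ)).setVar 11 (r : ℕ)) ↔
      ∃ R, Represents G X c r R ∧ IsPathList G s t R ∧ ∃ z : Fin n, P (z + 1) ∧
        R.length ≤ (z : ℕ) + 1 ∧ (z : ℕ) + 1 ≤ (extension G X R).card ∧
        ((closedNeighborhood G R).card : ℤ) ≤ τ.var 4 + ((z + 1 : ℕ) : ℤ) := by
    intro c r
    have h10 : ((τ.setVar 10 (c : ℕ)).setVar 11 (r : ℕ)).var 10 = (c : ℕ) :=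
      State.var_setVar_eq (State.setVar_var_same _ _ _)
    have h11 := State.setVar_var_same (τ.setVar 10 (c : ℕ)) 11 (r : ℕ)
    rw [holds_and, holds_pathTest h.setVar.setVar hm0 h10 h11 c.2 r.2
      (State.var_setVar_eq (State.var_setVar_eq hs)) (State.var_setVar_eq (State.var_setVar_eq ht)),
      pathTest_iff, ← exists_and_right]
    refine exists_congr fun R => ?_
    rw [and_assoc]
    refine and_congr_right fun hR => and_congr_right fun _ => ?_
    rw [holds_ex (State.var_setVar_eq (State.var_setVar_eq h.size))]
    refine exists_congr fun z => ?_
    have h17 := State.setVar_var_same ((τ.setVar 10 (c : ℕ)).setVar 11 (r : ℕ)) 17 (z : ℕ)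
    rw [holds_and, holds_and, holds_and, holds_not, holds_not, holds_lt, holds_lt, holds_lt,
      eval_extensionSize h.setVar.setVar.setVar hm0 (State.var_setVar_eq h10)
        (State.var_setVar_eq h11) c.2 r.2 hR,
      eval_neighborhoodSize h.setVar.setVar.setVar hm0 (State.var_setVar_eq h10)
        (State.var_setVar_eq h11) c.2 r.2 hR, he _ (State.var_setVar_eq (State.var_setVar_eq
          (State.var_setVar_eq rfl))) z h17]
    have h4 : (((τ.setVar 10 (c : ℕ)).setVar 11 (r : ℕ)).setVar 17 (z : ℕ)).var 4 = τ.var 4 :=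
      State.var_setVar_eq (State.var_setVar_eq (State.var_setVar_eq rfl))
    have hlen := hR.length
    simp only [eval, h17, h4, State.var_setVar_eq h11 (i := 17)]
    push_cast
    refine and_congr_right fun _ => and_congr ?_ (and_congr ?_ ?_) <;> omega
  have hlength : ∀ c : ℕ, (τ.setVar 10 c).var 7 = (2 * X.card : ℕ) := fun c =>
    State.var_setVar_eq h.length
  simp only [holds_ex (hlength _), key]
  constructor
  · rintro ⟨c, r, R, hR, hP, z, h1, h2, h3, h4⟩
    refine ⟨R, hP, fun v hv => ?_, by rw [hR.length]; omega, _, h1, h2, h3, h4⟩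
    obtain ⟨i, hi, rfl⟩ := List.mem_iff_getElem.1 hv
    exact (hR.codes i hi).1
  · rintro ⟨R, hP, hm, hlen, κ, h1, h2, h3, h4⟩
    obtain ⟨c, hc, hcodes⟩ := exists_code hm
    have hpos : 0 < R.length := by
      rw [List.length_pos_iff]; rintro rfl; simpa using hP.head
    -- A nonempty path has κ ≥ 1, and κ is at most the size of the extension, so κ − 1 is in the
    -- range of the loop over variable `17`.
    have hκ : κ ≤ n := h3.trans (by simpa using (extension G X R).card_le_univ)
    obtain ⟨z, rfl⟩ := Nat.exists_eq_add_of_le' (hpos.trans_le h2)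
    exact ⟨⟨c, hc.trans_le (Nat.pow_le_pow_right hm0 hlen)⟩, ⟨R.length - 1, by omega⟩, R,
      ⟨by simp only; omega, hcodes⟩, hP, ⟨z, by omega⟩, h1, h2, h3, h4⟩

end

end Term
end RAM

namespace RAM

open Secluded Term
open scoped Classical

/-! ## Twice a minimum twin cover -/

section Cover

variable {n : ℕ} {G : SimpleGraph (Fin n)} {X : Finset (Fin n)}

/-- `X` covers the edges between non-twins that satisfy `P`, and at least half of it is contained
in every twin cover. -/
structure PartialCover (G : SimpleGraph (Fin n)) (X : Finset (Fin n))
    (P : Fin n → Fin n → Prop) : Prop where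
  le : ∀ Y : Finset (Fin n), IsTwinCover G (Y : Set (Fin n)) → X.card ≤ 2 * (X ∩ Y).card
  cover : ∀ u v, P u v → G.Adj u v → ¬ AreTrueTwins G u v → u ∈ X ∨ v ∈ X

theorem PartialCover.mono {P Q : Fin n → Fin n → Prop} (h : PartialCover G X P)
    (hPQ : ∀ u v, Q u v → P u v ∨ u ∈ X ∨ v ∈ X ∨ (G.Adj u v → AreTrueTwins G u v)) :
    PartialCover G X Q :=
  ⟨h.le, fun u v hQ huv ht => by
    rcases hPQ u v hQ with h' | h' | h' | h'
    · exact h.cover u v h' huv ht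
    · exact .inl h'
    · exact .inr h'
    · exact absurd (h' huv) ht⟩

/-- Every twin cover contains an endpoint of this edge. So |X| grows by at most two and its
intersection with any twin cover by at least one. -/
theorem PartialCover.insert {P Q : Fin n → Fin n → Prop} (h : PartialCover G X P) {a b : Fin n}
    (hab : G.Adj a b) (ht : ¬ AreTrueTwins G a b) (ha : a ∉ X) (hb : b ∉ X)
    (hPQ : ∀ u v, Q u v → P u v ∨ u = a ∧ v = b) :
    PartialCover G (insert b (insert a X)) Q := by
  refine ⟨fun Y hY => ?_, fun u v hQ huv ht => ?_⟩
  · have h1 := h.le Y hY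
    have h2 : (X ∩ Y).card + 1 ≤ (Insert.insert b (Insert.insert a X) ∩ Y).card := by
      obtain ⟨w, hwY, hwX, hw⟩ : ∃ w ∈ Y, w ∉ X ∧ (w = a ∨ w = b) := by
        rcases hY a b hab with h | h | h
        · exact ⟨a, by simpa using h, ha, .inl rfl⟩
        · exact ⟨b, by simpa using h, hb, .inr rfl⟩
        · exact absurd h ht
      rw [← Finset.card_insert_of_notMem (a := w) (by simp [hwX])]
      refine Finset.card_le_card fun x hx => ?_
      simp only [Finset.mem_insert, Finset.mem_inter] at hx ⊢
      rcases hx with rfl | hx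
      · exact ⟨by tauto, hwY⟩
      · exact ⟨by tauto, hx.2⟩
    have h3 := Finset.card_insert_le b (Insert.insert a X)
    have h4 := Finset.card_insert_le a X
    omega
  · simp only [Finset.mem_insert]
    rcases hPQ u v hQ with h' | ⟨rfl, rfl⟩
    · have := h.cover u v h' huv ht
      tauto
    · tauto

theorem Term.Holding.setArr {τ : State} (h : Holding G X τ) (a : Fin n) :
    Holding G (insert a X) (τ.setArr 1 (a : ℕ) 1) := by
  refine ⟨h.size, fun u v => ?_, fun v => ?_⟩
  · rw [State.setArr_arr, if_neg (by simp), h.adj]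
  · rw [State.setArr_arr, h.mem]
    simp only [true_and, Nat.cast_inj, Fin.val_inj, Finset.mem_insert]
    by_cases hva : v = a <;> simp [hva]

/-- The current edge is not covered yet. -/
def uncovered : Term := (nontwinEdge 10 11).and ((inCover 10).not.and (inCover 11).not)

/-- The greedy 2-approximation. It scans all ordered pairs, and array `1`, initially zero, records
the cover. -/
def coverProgram : Program :=
  forLoop 10 0 (forLoop 11 0 (.seq (compile 100 uncovered) (.ite (.var 100)
    (.seq (.store 1 (.var 10) (.lit 1)) (.store 1 (.var 11) (.lit 1))) .skip)))

/-- The state of the computation of a cover, when the pairs in `P` have been processed. -/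
def Covering (G : SimpleGraph (Fin n)) (σ : State) (P : Fin n → Fin n → Prop) (τ : State) : Prop :=
  (∀ y < 5, τ.var y = σ.var y) ∧ ∃ X, Holding G X τ ∧ PartialCover G X P

theorem Covering.setVar {σ τ : State} {P : Fin n → Fin n → Prop} (h : Covering G σ P τ) {i : ℕ}
    (z : ℤ) (hi : 5 ≤ i := by omega) : Covering G σ P (τ.setVar i z) := by
  obtain ⟨h1, X, h2, h3⟩ := h
  exact ⟨fun y hy => State.var_setVar_eq (h1 y hy), X, h2.setVar, h3⟩

theorem Covering.mono {σ τ : State} {P Q : Fin n → Fin n → Prop} (h : Covering G σ P τ)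
    (hPQ : ∀ u v, Q u v → P u v) : Covering G σ Q τ := by
  obtain ⟨h1, X, h2, h3⟩ := h
  exact ⟨h1, X, h2, h3.mono fun u v h => .inl (hPQ u v h)⟩

theorem coverProgram_step {σ τ : State} {B : ℕ} (hnB : n ≤ B) {a b : Fin n}
    (h : Covering G σ (fun u v => u < a ∨ u = a ∧ v < b) τ) (ha : τ.var 10 = (a : ℕ))
    (hb : τ.var 11 = (b : ℕ)) :
    Achieves (.seq (compile 100 uncovered) (.ite (.var 100)
      (.seq (.store 1 (.var 10) (.lit 1)) (.store 1 (.var 11) (.lit 1))) .skip)) τ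
      (uncovered.cost B + 8) fun υ => (Covering G σ (fun u v => u < a ∨ u = a ∧ v ≤ b) υ ∧
        υ.var 10 = (a : ℕ)) ∧ υ.var 11 = (b : ℕ) := by
  obtain ⟨h1, X, h2, h3⟩ := h
  have hfit : Fits B [0, 1, 2, 3, 4, 10, 11] τ := by
    refine ⟨by decide, fun y hy hb => ?_⟩
    have : y = 0 := by
      revert hb; revert y; decide
    exact ⟨n, hnB, by rw [this, h2.size]⟩
  refine Achieves.seq (T₂ := 8) (compile_spec uncovered
    (vs := [0, 1, 2, 3, 4, 10, 11]) (by decide) le_rfl hfit) ?_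
  rintro υ ⟨h4, h5⟩
  have hυ : ∀ y ∈ [0, 1, 2, 3, 4, 10, 11], υ.var y = τ.var y := fun y hy => h5.var y (.inl hy)
  have hva : υ.var 10 = (a : ℕ) := by rw [hυ 10 (by simp), ha]
  have hvb : υ.var 11 = (b : ℕ) := by rw [hυ 11 (by simp), hb]
  have hin : ∀ y < 5, υ.var y = σ.var y := fun y hy => by
    rw [hυ y (by simp; omega), h1 y hy]
  have h6 : Holding G X υ :=
    ⟨by rw [hυ 0 (by simp), h2.size], by rw [h5.arr]; exact h2.adj, by rw [h5.arr]; exact h2.mem⟩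
  have h7 : υ.var 100 ≠ 0 ↔ (G.Adj a b ∧ ¬ AreTrueTwins G a b) ∧ a ∉ X ∧ b ∉ X := by
    rw [h4, ← Holds, uncovered, holds_and, holds_and, holds_not, holds_not,
      holds_nontwinEdge h2 ha hb (by omega) (by omega), holds_inCover h2 ha, holds_inCover h2 hb]
  refine Achieves.ite (T := 6) (e := .var 100) (fun hne => ?_) (fun heq => ?_)
  · obtain ⟨⟨hab, ht⟩, haX, hbX⟩ := h7.1 hne
    refine Achieves.seq (T₁ := 3) (T₂ := 3) (Achieves.store (Q := fun ρ =>
      ρ = υ.setArr 1 (a : ℕ) 1) (by simp [Expr.value, hva])) ?_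
    rintro _ rfl
    refine Achieves.store (i := .var 11) (e := .lit 1) ?_
    simp only [Expr.value, State.setArr_var, hvb]
    refine ⟨⟨⟨hin, _, (h6.setArr a).setArr b, h3.insert hab ht haX hbX fun u v h => ?_⟩, hva⟩, trivial⟩
    rcases h with h | ⟨rfl, h⟩
    · exact .inl (.inl h)
    · rcases h.lt_or_eq with h | rfl
      · exact .inl (.inr ⟨rfl, h⟩)
      · exact .inr ⟨rfl, rfl⟩
  · refine (Achieves.skip ⟨⟨⟨hin, X, h6, h3.mono fun u v h => ?_⟩, hva⟩, hvb⟩).mono (by omega)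
      fun _ h => h
    have h8 := mt h7.2 (not_not.2 heq)
    rcases h with h | ⟨rfl, h⟩
    · exact .inl (.inl h)
    · rcases h.lt_or_eq with h | rfl
      · exact .inl (.inr ⟨rfl, h⟩)
      · tauto

/-- The pairs are processed in lexicographic order. The time is stated as the cost of a doubly
nested sum so that `cost_le` applies to it. -/
theorem coverProgram_spec {σ : State} (hσ : Holding G ∅ σ) {B : ℕ} (hnB : n ≤ B) :
    Achieves coverProgram σ ((sum 0 0 (sum 0 0 uncovered)).cost B)
      (Covering G σ fun _ _ => True) := by
  have hin : ∀ {τ : State} {P : Fin n → Fin n → Prop}, Covering G σ P τ → τ.var 0 = n :=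
    fun h => by rw [h.1 0 (by omega), hσ.size]
  refine Achieves.mono (T := B * ((B * ((uncovered.cost B + 8) + 8) + 6) + 8) + 6)
    (Achieves.forLoop (by omega) hσ.size hnB (fun z => Covering G σ fun u _ => (u : ℕ) < z)
      ?_ (fun z τ x h => h.setVar x) ?_) ?_ ?_
  · refine Covering.setVar ⟨fun _ _ => rfl, ∅, hσ, ?_, ?_⟩ _
    · intro Y _; simp
    · intro u v h; simp at h
  · intro z τ hz h hτ _
    refine (Achieves.forLoop (by omega) (hin h) hnB (fun w τ =>
      Covering G σ (fun u v => u < (⟨z, hz⟩ : Fin n) ∨ u = ⟨z, hz⟩ ∧ (v : ℕ) < w) τ ∧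
        τ.var 10 = (z : ℕ)) ?_ ?_ ?_).mono le_rfl ?_
    · refine ⟨(h.mono fun u v h => ?_).setVar _, State.var_setVar_eq hτ⟩
      simpa [Fin.lt_def] using h
    · rintro w υ x ⟨h1, h2⟩
      exact ⟨h1.setVar x, State.var_setVar_eq h2⟩
    · rintro w υ hw ⟨h1, h2⟩ hυ _
      refine (coverProgram_step hnB (b := ⟨w, hw⟩) h1 h2 hυ).mono le_rfl ?_
      rintro ρ ⟨⟨h3, h4⟩, h5⟩
      refine ⟨⟨h3.mono fun u v h => ?_, h4⟩, h5, hin h3⟩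
      simpa [Fin.le_def, Nat.lt_succ_iff] using h
    · rintro υ ⟨⟨h1, h2⟩, h3⟩
      refine ⟨h1.mono fun u v h => ?_, h2, h3⟩
      rcases Nat.lt_succ_iff_lt_or_eq.1 h with h | h
      · exact .inl h
      · exact .inr ⟨Fin.ext h, v.2⟩
  · simp only [cost]
    have := Nat.mul_le_mul_left B (show (B * ((uncovered.cost B + 8) + 8) + 6) + 8 ≤
      (B * (uncovered.cost B + 20) + 20) + 20 by nlinarith)
    omega
  · rintro τ ⟨h, _⟩
    exact h.mono fun u v _ => u.2

/-- The factor two, applied to a minimum twin cover. -/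
theorem PartialCover.card_le (h : PartialCover G X fun _ _ => True) :
    X.card ≤ 2 * twinCoverNumber G := by
  have hne : {m : ℕ | ∃ X : Finset (Fin n), IsTwinCover G (X : Set (Fin n)) ∧ X.card = m}.Nonempty :=
    ⟨_, Finset.univ, fun u _ _ => .inl (by simp), rfl⟩
  obtain ⟨Y, hY, hc⟩ := Nat.sInf_mem hne
  rw [twinCoverNumber, ← hc]
  exact (h.le Y hY).trans (Nat.mul_le_mul_left _ (Finset.card_le_card Finset.inter_subset_right))

theorem PartialCover.isTwinCover (h : PartialCover G X fun _ _ => True) {Y : Finset (Fin n)}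
    (hXY : X ⊆ Y) : IsTwinCover G (Y : Set (Fin n)) := by
  intro u v huv
  by_cases ht : AreTrueTwins G u v
  · exact .inr (.inr ht)
  · rcases h.cover u v trivial huv ht with h' | h'
    · exact .inl (hXY h')
    · exact .inr (.inl (hXY h'))

end Cover

/-! ## The algorithm -/

/-- Evaluate a term into the variable `x`. -/
def evaluate (x : ℕ) (e : Term) : Program := .seq (compile 100 e) (.assign x (.var 100))

theorem evaluate_spec {B x : ℕ} {vs : List ℕ} {e : Term} (he : e.Scoped vs) {σ : State}
    (hf : Fits B vs σ) (hx : x ∉ vs) :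
    Achieves (evaluate x e) σ (e.cost B + 2) fun τ => τ.var x = e.eval σ ∧ Frame vs 100 σ τ := by
  refine Achieves.seq (compile_spec e he le_rfl hf) ?_
  rintro τ ⟨h1, h2⟩
  exact Achieves.assign (e := .var 100) ⟨by simp [Expr.value, h1], h2.setVar _ hx (by omega)⟩

/-- A freshly computed register joins the scope and may bound later loops. -/
theorem Term.Fits.cons {B x : ℕ} {vs : List ℕ} {σ τ : State} (h : Fits B vs σ)
    (hf : Frame vs 100 σ τ) (hx : x < 100) {N : ℕ} (hN : τ.var x = N) (hNB : N ≤ B) :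
    Fits B (x :: vs) τ := by
  refine ⟨by simpa [hx] using h.lt, fun y hy hb => ?_⟩
  rcases List.mem_cons.1 hy with rfl | hy
  · exact ⟨N, hNB, hN⟩
  · exact (h.frame hf).le y hy hb

theorem Term.Holding.frame {n : ℕ} {G : SimpleGraph (Fin n)} {X : Finset (Fin n)}
    {vs : List ℕ} {σ τ : State} (h : Holding G X σ) (hf : Frame vs 100 σ τ) (h0 : 0 ∈ vs) :
    Holding G X τ :=
  ⟨by rw [hf.var 0 (.inl h0), h.size], by rw [hf.arr]; exact h.adj, by rw [hf.arr]; exact h.mem⟩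

def power : Term := fold 60 7 (lit 1) (sum 72 6 (var 61))

theorem eval_power {τ : State} {m L : ℕ} (hm : τ.var 6 = m) (hL : τ.var 7 = L) :
    power.eval τ = (m ^ L : ℕ) := by
  rw [power, eval, hL, Int.toNat_natCast]
  clear hL
  induction L with
  | zero => simp [eval]
  | succ L ih =>
    simp only [ih]
    rw [eval_sum (State.var_setVar_eq (State.var_setVar_eq hm))]
    simp only [eval, State.setVar_var_ne _ _ (show 61 ≠ 72 by omega), State.setVar_var_same,
      Finset.sum_const, Finset.card_univ, Fintype.card_fin, nsmul_eq_mul]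
    rw [pow_succ', Nat.cast_mul]

/-- Registers `5` to `8` receive |X|, the number m of marked vertices, 2|X| and m^{2|X|}, and bound
the loops of the search. Before that, s and t join the cover, as the exchange arguments require. -/
def algorithm (r : Term) : Program :=
  .seq coverProgram (.seq (.store 1 (.var 1) (.lit 1)) (.seq (.store 1 (.var 2) (.lit 1))
    (.seq (evaluate 5 (count 15 0 (inCover 15))) (.seq (evaluate 6 (count 15 0 (isMarked 15)))
      (.seq (evaluate 7 (.add (.var 5) (.var 5))) (.seq (evaluate 8 power)
        (evaluate 0 (answer r))))))))

/-- A term that takes as long to evaluate as the algorithm takes to run. -/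
def timeTerm (r : Term) : Term :=
  .add (.sum 0 0 (.sum 0 0 uncovered)) (.add (count 15 0 (inCover 15))
    (.add (count 15 0 (isMarked 15)) (.add (.add (.var 5) (.var 5)) (.add power (answer r)))))

section

variable {n : ℕ} {G : SimpleGraph (Fin n)} {X : Finset (Fin n)} {s t : Fin n} {l : ℤ} {r : Term}
  {P : ℕ → Prop} {B : ℕ}

theorem store_spec {x : ℕ} {σ τ : State} {a : Fin n}
    (hτ : ∀ y < 5, τ.var y = σ.var y) (hX : Holding G X τ) (hx : x < 5) (ha : σ.var x = (a : ℕ)) :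
    Achieves (.store 1 (.var x) (.lit 1)) τ 3 fun υ =>
      (∀ y < 5, υ.var y = σ.var y) ∧ Holding G (insert a X) υ := by
  refine Achieves.store (i := .var x) (e := .lit 1) ?_
  simp only [Expr.value, hτ x hx, ha]
  exact ⟨hτ, hX.setArr a⟩

/-- The algorithm, once the cover has been computed. -/
theorem algorithm_tail_spec {σ : State} (hX : IsTwinCover G (X : Set (Fin n))) (hsX : s ∈ X)
    (htX : t ∈ X) (hσ : Holding G X σ) (hs : σ.var 1 = (s : ℕ)) (ht : σ.var 2 = (t : ℕ))
    (hr : (answer r).Scoped [8, 7, 6, 5, 0, 1, 2, 3, 4])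
    (hP : ∀ υ : State, υ.var 3 = σ.var 3 → ∀ z : ℕ, υ.var 17 = z → (r.Holds υ ↔ P (z + 1)))
    (hB : 2 * n + (marked G X).card ^ (2 * X.card) ≤ B) :
    Achieves (.seq (evaluate 5 (count 15 0 (inCover 15)))
      (.seq (evaluate 6 (count 15 0 (isMarked 15))) (.seq (evaluate 7 (.add (.var 5) (.var 5)))
        (.seq (evaluate 8 power) (evaluate 0 (answer r)))))) σ
      ((count 15 0 (inCover 15)).cost B + 2 + ((count 15 0 (isMarked 15)).cost B + 2 +
        ((Term.add (.var 5) (.var 5)).cost B + 2 + (power.cost B + 2 + ((answer r).cost B + 2)))))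
      fun τ => τ.var 0 = if ∃ R, IsPathList G s t R ∧ P R.length ∧
        IsSecluded G (σ.var 4) {v | v ∈ R} then 1 else 0 := by
  have hq : X.card ≤ n := by simpa using X.card_le_univ
  have hm : (marked G X).card ≤ n := by simpa using (marked G X).card_le_univ
  have f₀ : Fits B [0, 1, 2, 3, 4] σ := by
    refine ⟨by decide, fun y hy hb => ?_⟩
    have : y = 0 := by
      revert hb; revert y; decide
    exact ⟨n, by omega, by rw [this, hσ.size]⟩
  refine Achieves.seq (evaluate_spec (by decide) f₀ (by decide)) ?_
  rintro σ₁ ⟨h₁, g₁⟩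
  have k₁ := hσ.frame g₁ (by decide)
  rw [eval_count hσ.size _ _ (fun v => v ∈ X) fun v => holds_inCover hσ.setVar
    (State.setVar_var_same _ _ _), Finset.filter_univ_mem] at h₁
  have f₁ := f₀.cons g₁ (by decide) h₁ (by omega)
  refine Achieves.seq (evaluate_spec (by decide) f₁ (by decide)) ?_
  rintro σ₂ ⟨h₂, g₂⟩
  have k₂ := k₁.frame g₂ (by decide)
  rw [eval_count k₁.size _ _ (fun v => v ∈ marked G X) fun v => holds_isMarked k₁.setVar
    (State.var_setVar_eq h₁) (State.setVar_var_same _ _ _) (by omega) (by omega),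
    Finset.filter_univ_mem] at h₂
  have f₂ := f₁.cons g₂ (by decide) h₂ (by omega)
  refine Achieves.seq (evaluate_spec (by decide) f₂ (by decide)) ?_
  rintro σ₃ ⟨h₃, g₃⟩
  have k₃ := k₂.frame g₃ (by decide)
  have h₃' : σ₃.var 7 = (2 * X.card : ℕ) := by
    rw [h₃, eval, eval, g₂.var 5 (.inl (by decide)), h₁]
    push_cast
    ring
  have f₃ := f₂.cons g₃ (by decide) h₃' (by omega)
  refine Achieves.seq (evaluate_spec (by decide) f₃ (by decide)) ?_
  rintro σ₄ ⟨h₄, g₄⟩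
  have k₄ := k₃.frame g₄ (by decide)
  rw [eval_power (by rw [g₃.var 6 (.inl (by decide)), h₂]) h₃'] at h₄
  have f₄ := f₃.cons g₄ (by decide) h₄ (by omega)
  have prep : Prepared G X σ₄ :=
    { toHolding := k₄
      cover := by
        rw [g₄.var 5 (.inl (by decide)), g₃.var 5 (.inl (by decide)), g₂.var 5 (.inl (by decide)),
          h₁]
      base := by rw [g₄.var 6 (.inl (by decide)), g₃.var 6 (.inl (by decide)), h₂]
      length := by rw [g₄.var 7 (.inl (by decide)), h₃']
      bound := h₄ }
  have hin : ∀ y ∈ [0, 1, 2, 3, 4], σ₄.var y = σ.var y := fun y hy => by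
    rw [g₄.var y (.inl (by simp at hy ⊢; tauto)), g₃.var y (.inl (by simp at hy ⊢; tauto)),
      g₂.var y (.inl (by simp at hy ⊢; tauto)), g₁.var y (.inl hy)]
  have hans := holds_answer prep hX hsX htX (by rw [hin 1 (by decide), hs])
    (by rw [hin 2 (by decide), ht]) (e := r) (P := P) (by rw [hin 3 (by decide)]; exact hP)
  rw [hin 4 (by decide)] at hans
  refine Achieves.seq (compile_spec (answer r) hr le_rfl f₄) ?_
  rintro σ₅ ⟨h₅, -⟩
  refine Achieves.assign (e := .var 100) ?_
  -- The outermost operation of `answer` is a comparison, so the value is exactly 0 or 1.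
  rw [State.setVar_var_same, Expr.value, h₅, ← hans, answer, ex]
  exact if_congr holds_lt.symm rfl rfl

/-- Which cover the greedy phase finds is left open, so `B` must bound the rounds for every set of
the guaranteed size. -/
theorem algorithm_spec {σ : State} (hσ : Holding G ∅ σ) (hs : σ.var 1 = (s : ℕ))
    (ht : σ.var 2 = (t : ℕ)) (hr : (answer r).Scoped [8, 7, 6, 5, 0, 1, 2, 3, 4])
    (hP : ∀ υ : State, υ.var 3 = σ.var 3 → ∀ z : ℕ, υ.var 17 = z → (r.Holds υ ↔ P (z + 1)))
    (hB : ∀ X : Finset (Fin n), X.card ≤ 2 * twinCoverNumber G + 2 →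
      2 * n + (marked G X).card ^ (2 * X.card) ≤ B) :
    Achieves (algorithm r) σ ((timeTerm r).cost B) fun τ => τ.var 0 =
      if ∃ R, IsPathList G s t R ∧ P R.length ∧ IsSecluded G (σ.var 4) {v | v ∈ R} then 1 else 0 := by
  have hnB : n ≤ B := by have := hB ∅ (by simp); omega
  refine Achieves.mono (Achieves.seq (coverProgram_spec hσ hnB) ?_) (T' := (timeTerm r).cost B)
    (T := (Term.sum 0 0 (.sum 0 0 uncovered)).cost B + (3 + (3 +
      ((count 15 0 (inCover 15)).cost B + 2 + ((count 15 0 (isMarked 15)).cost B + 2 +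
        ((Term.add (.var 5) (.var 5)).cost B + 2 + (power.cost B + 2 +
          ((answer r).cost B + 2)))))))) ?_ fun _ h => h
  · rintro τ ⟨h1, X, h2, h3⟩
    refine Achieves.seq (store_spec h1 h2 (by omega) hs) ?_
    rintro τ₁ ⟨h4, h5⟩
    refine Achieves.seq (store_spec h4 h5 (by omega) ht) ?_
    rintro τ₂ ⟨h6, h7⟩
    have hcard : (insert t (insert s X)).card ≤ 2 * twinCoverNumber G + 2 := by
      have := h3.card_le
      have := Finset.card_insert_le t (insert s X)
      have := Finset.card_insert_le s X
      omega
    have := algorithm_tail_spec (s := s) (t := t) (P := P) (h3.isTwinCover fun x hx => by simp [hx]) (by simp)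
      (by simp) h7 (by rw [h6 1 (by omega), hs]) (by rw [h6 2 (by omega), ht]) hr
      (by rw [h6 3 (by omega)]; exact hP) (hB _ hcard)
    rwa [h6 4 (by omega)] at this
  -- The five additions in `timeTerm` contribute 50 steps, enough for the stores and the final
  -- assignments.
  · rw [timeTerm]
    simp only [cost]
    omega

/-- Division with remainder by `n` recovers the pair from its cell, so cells of different pairs do
not collide. -/
theorem holding_inputState (G : SimpleGraph (Fin n)) (s t : Fin n) (k l : ℤ) :
    Holding G ∅ (inputState G s t k l) := by
  refine ⟨rfl, fun u v => ?_, fun v => by simp [inputState]⟩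
  simp only [inputState, true_and]
  refine if_congr ⟨?_, fun h => ⟨u, v, h, by push_cast; ring⟩⟩ rfl rfl
  rintro ⟨u', v', h, he⟩
  have he' : n * (u : ℕ) + v = n * u' + v' := by
    rw [mul_comm n (u' : ℕ)]
    exact_mod_cast he
  have hn : 0 < n := u.pos
  have h1 : u = u' := by
    have := congrArg (· / n) he'
    simp only [Nat.mul_add_div hn, Nat.div_eq_of_lt v.2, Nat.div_eq_of_lt v'.2, add_zero] at this
    exact Fin.ext this
  subst h1
  have h2 : v = v' := Fin.ext (by omega)
  subst h2
  exact h

/-- With q = |X|, q + q·2^q ≤ 2^{2q+1}, so there are at most 2^{(2q+1)·2q} codes. The two extra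
units in the exponent come from 2n + Z + 1 ≤ 4nZ. -/
theorem rounds_le (G : SimpleGraph (Fin n)) (hn : 0 < n) {X : Finset (Fin n)} {c : ℕ}
    (hX : X.card ≤ 2 * c + 2) :
    2 * n + (marked G X).card ^ (2 * X.card) + 1 ≤ n * 2 ^ (52 * c ^ 2 + 22) := by
  have h1 : (marked G X).card ≤ 2 ^ (2 * X.card + 1) := by
    have h := card_marked_le G X
    have h2 : X.card < 2 ^ X.card := Nat.lt_two_pow_self
    have h3 : 2 ^ (2 * X.card + 1) = 2 ^ X.card * 2 ^ X.card * 2 := by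
      rw [pow_succ, two_mul, pow_add]
    nlinarith
  have h2 : (marked G X).card ^ (2 * X.card) ≤ 2 ^ (52 * c ^ 2 + 20) := by
    refine (Nat.pow_le_pow_left h1 _).trans ?_
    rw [← pow_mul]
    refine Nat.pow_le_pow_right (by omega) ?_
    -- The product is 16c² + 36c + 20, and c ≤ c² gives 52c² + 20.
    have h3 : (2 * X.card + 1) * (2 * X.card) ≤ (4 * c + 5) * (4 * c + 4) :=
      Nat.mul_le_mul (by omega) (by omega)
    nlinarith [Nat.le_self_pow (n := 2) (by omega) c]
  have h3 : 1 ≤ 2 ^ (52 * c ^ 2 + 20) := Nat.one_le_two_pow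
  have h4 : 2 ^ (52 * c ^ 2 + 22) = 4 * 2 ^ (52 * c ^ 2 + 20) := by
    rw [show 52 * c ^ 2 + 22 = 52 * c ^ 2 + 20 + 2 by omega, pow_add, mul_comm]
    norm_num
  rw [h4]
  generalize 2 ^ (52 * c ^ 2 + 20) = Z at *
  nlinarith

/-- The algorithm decides whether there is a secluded path whose length satisfies `P k`. -/
theorem algorithm_answers {P : ℤ → ℕ → Prop} (hr : (answer r).Scoped [8, 7, 6, 5, 0, 1, 2, 3, 4])
    (hP : ∀ υ : State, ∀ z : ℕ, υ.var 17 = z → (r.Holds υ ↔ P (υ.var 3) (z + 1))) :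
    ∃ a b d : ℕ, ∀ (n : ℕ) (G : SimpleGraph (Fin n)) (s t : Fin n) (k l : ℤ),
      AnswersWithin (algorithm r) (inputState G s t k l)
        (∃ p : G.Walk s t, p.IsPath ∧ P k p.support.length ∧ IsSecluded G l {v | v ∈ p.support})
        (a * 2 ^ (b * twinCoverNumber G ^ 2) * n ^ d) := by
  obtain ⟨K, D, hKD⟩ := cost_le (timeTerm r)
  refine ⟨K * 2 ^ (22 * D), 52 * D, D, fun n G s t k l => ?_⟩
  -- `B` is one less than the product so that `B + 1`, the base in `cost_le`, is exactly the product
  -- and its D-th power splits. Here n > 0 because of the vertex s.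
  have hB : ∀ X : Finset (Fin n), X.card ≤ 2 * twinCoverNumber G + 2 →
      2 * n + (marked G X).card ^ (2 * X.card) ≤ n * 2 ^ (52 * twinCoverNumber G ^ 2 + 22) - 1 :=
    fun X hX => Nat.le_sub_one_of_lt (rounds_le G s.pos hX)
  obtain ⟨τ, T, h1, h2, h3⟩ := algorithm_spec (P := P k) (holding_inputState G s t k l) (s := s)
    (t := t) rfl rfl hr (fun υ hυ z hz => by rw [hP υ z hz, hυ]; rfl) hB
  refine ⟨τ, T, h1, h2.trans ((hKD _).trans (le_of_eq ?_)), h3.trans ?_⟩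
  · rw [Nat.sub_add_cancel (Nat.mul_pos s.pos (by positivity)), mul_pow, ← pow_mul, add_mul, pow_add,
      mul_right_comm 52]
    ring
  · refine if_congr ?_ rfl rfl
    rw [exists_path_iff G s t fun R => P k R.length ∧ IsSecluded G l {v | v ∈ R}]
    rfl

end

end RAM

/-- Secluded `k`-Path and Short Secluded Path are solvable in `2^{O(tc(G)²)} n^{O(1)}` time. -/
theorem mainTheorem3 :
    (∃ (prog : RAM.Program) (a b d : ℕ),
      ∀ (n : ℕ) (G : SimpleGraph (Fin n)) (s t : Fin n) (k l : ℤ),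
        RAM.AnswersWithin prog (RAM.inputState G s t k l)
          (Secluded.SecludedKPath G s t k l)
          (a * 2 ^ (b * Secluded.twinCoverNumber G ^ 2) * n ^ d)) ∧
    (∃ (prog : RAM.Program) (a b d : ℕ),
      ∀ (n : ℕ) (G : SimpleGraph (Fin n)) (s t : Fin n) (k l : ℤ),
        RAM.AnswersWithin prog (RAM.inputState G s t k l)
          (Secluded.ShortSecludedPath G s t k l)
          (a * 2 ^ (b * Secluded.twinCoverNumber G ^ 2) * n ^ d)) := by
  -- The problems differ only in the test comparing the length, variable `17` plus one, with k in
  -- variable `3`.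
  refine ⟨⟨_, RAM.algorithm_answers (P := fun k m => (m : ℤ) = k)
    (r := .eq (.add (.var 17) (.lit 1)) (.var 3)) (by decide) fun υ z hz => ?_⟩,
    ⟨_, RAM.algorithm_answers (P := fun k m => (m : ℤ) ≤ k)
    (r := RAM.Term.not (.lt (.var 3) (.add (.var 17) (.lit 1)))) (by decide) fun υ z hz => ?_⟩⟩
  · rw [RAM.Term.holds_eq]
    simp [RAM.Term.eval, hz]
  · rw [RAM.Term.holds_not, RAM.Term.holds_lt]
    simp [RAM.Term.eval, hz]
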